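/- All graphs are finite and simple. For graphs $H,G$ let $\mathrm{ind}(H,G)$ be the number of sets $S\subseteq V(G)$ such that the induced subgraph $G[S]$ is isomorphic to $H$, and let $\mathcal G_k$ be the set of isomorphism classes of graphs with at most $k$ vertices. A graph polynomial $p$ assigns to each graph $G$ a polynomial $p(G)=\sum_{i\ge 0} e_i(G)z^i\in\mathbb C[z]$ that depends only on the isomorphism class of $G$. It is multiplicative if $p(\emptyset)=1$ and $p(G_1\cup G_2)=p(G_1)p(G_2)$ for disjoint unions. A multiplicative graph polynomial $p$ with $e_0(G)=1$ for all $G$ is a bounded induced graph counting polynomial (BIGCP) if there are constants $\alpha,\beta\in\mathbb N$ and complex numbers $\lambda_{H,i}$ such that (i) $e_i(G)=\sum_{H\in\mathcal G_{\alpha i}}\lambda_{H,i}\,\mathrm{ind}(H,G)$ for all graphs $G$ and all $i$ (where $e_i(G)=0$ for $i>\deg p(G)$), and (ii) there is an algorithm that, given $i$ and a graph $H$ with at most $\alpha i$ vertices, computes $\lambda_{H,i}$ in time $O(\beta^{|V(H)|})$. The $j$-th inverse power sum of a polynomial with non-zero roots $\zeta_1,\dots,\zeta_d$ (with multiplicity)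 is $\zeta_1^{-j}+\dots+\zeta_d^{-j}$. Algorithms are deterministic programs on lists and exact real numbers, with unit cost for list operations and for arithmetic and comparison of reals, and may use real constants; graphs are given by adjacency lists, and complex numbers by their real and imaginary parts. Theorem. Let $C>0$ and $\Delta\in\mathbb N$, and let $p$ be a BIGCP. Then there are a deterministic algorithm and a constant $K$ such that, given any $n\ge 1$, any $n$-vertex graph $G$ of maximum degree at most $\Delta$ and any real $\varepsilon>0$, the algorithm computes the inverse power sums $p_1,\dots,p_m$ of $p(G)$ for $m=\max(0,\lceil C\ln(n/\varepsilon)\rceil)$ in time at most $K\max(n,n/\varepsilon)^K$. In particular, for $\varepsilon\le 1$ the running time is $(n/\varepsilon)^{O(1)}$. -/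

import Mathlib

open Polynomial

noncomputable section

/-! ### Isomorphism classes of finite graphs -/

/-- Two finite graphs with vertex sets `Fin m`, `Fin n` are identified if they are isomorphic. -/
instance graphSetoid : Setoid (Σ n : ℕ, SimpleGraph (Fin n)) where
  r G H := Nonempty (G.2 ≃g H.2)
  iseqv :=
    { refl := fun _ => ⟨SimpleGraph.Iso.refl⟩
      symm := fun ⟨e⟩ => ⟨e.symm⟩
      trans := fun ⟨e⟩ ⟨f⟩ => ⟨e.trans f⟩ }

/-- The collection of all finite simple graphs, up to isomorphism. A graph invariant with values
in `S` is a function `GraphClass → S`. -/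
def GraphClass : Type := Quotient graphSetoid

/-- The isomorphism class of a finite graph. -/
def isoClass {V : Type*} [Finite V] (G : SimpleGraph V) : GraphClass :=
  Quotient.mk graphSetoid ⟨Nat.card V, G.comap (Finite.equivFin V).symm⟩

/-- The number of vertices. -/
def GraphClass.order (H : GraphClass) : ℕ :=
  Quotient.lift (s := graphSetoid) (fun G : Σ n : ℕ, SimpleGraph (Fin n) => G.1)
    (fun _ _ ⟨e⟩ => by simpa using Fintype.card_congr e.toEquiv) H

theorem isoClass_eq_iff {V W : Type*} [Finite V] [Finite W]
    (G : SimpleGraph V) (H : SimpleGraph W) :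
    isoClass G = isoClass H ↔ Nonempty (G ≃g H) := by
  have key : ∀ {U : Type _} [Finite U] (F : SimpleGraph U),
      Nonempty (F.comap (Finite.equivFin U).symm ≃g F) :=
    fun F => ⟨⟨(Finite.equivFin _).symm, Iff.rfl⟩⟩
  have key' : ∀ {U : Type _} [Finite U] (F : SimpleGraph U),
      Nonempty (F.comap (Finite.equivFin U).symm ≃g F) :=
    fun F => ⟨⟨(Finite.equivFin _).symm, Iff.rfl⟩⟩
  obtain ⟨a⟩ := key G
  obtain ⟨b⟩ := key' H
  constructor
  · intro h
    obtain ⟨e⟩ := Quotient.exact (s := graphSetoid) h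
    exact ⟨a.symm.trans (RelIso.trans e b)⟩
  · rintro ⟨e⟩
    exact Quotient.sound (s := graphSetoid) ⟨a.trans (e.trans b.symm)⟩

theorem GraphClass.finite_order_le (k : ℕ) : {H : GraphClass | H.order ≤ k}.Finite := by
  have h : (Set.range fun G : Σ n : Fin (k + 1), SimpleGraph (Fin n) =>
      (Quotient.mk graphSetoid ⟨G.1, G.2⟩ : GraphClass)).Finite := Set.finite_range _
  refine h.subset ?_
  intro H hH
  induction H using Quotient.inductionOn with
  | h G => exact ⟨⟨⟨G.1, Nat.lt_succ_of_le hH⟩, G.2⟩, rfl⟩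

/-- The graphs with at most `k` vertices, up to isomorphism. -/
def GraphClass.orderLE (k : ℕ) : Finset GraphClass := (GraphClass.finite_order_le k).toFinset

/-- `ind H G` is the number of vertex sets `S` such that `G[S]` is isomorphic to `H`. -/
def ind (H : GraphClass) {V : Type*} [Finite V] (G : SimpleGraph V) : ℕ :=
  {S : Set V | isoClass (G.induce S) = H}.ncard

/-! ### The model of computation

Data are S-expressions whose atoms are `nil` and real numbers. Programs are the point-free
programs of pure Lisp over these data. The primitive operations are `cons` / `car` / `cdr`, a type
test, the four arithmetic operations on exact real numbers, real constants and the comparison of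
two reals, all at unit cost, as in the real RAM and in the Blum–Shub–Smale model. As S-expressions
are immutable, handing one on is copying a pointer, so that every unit of cost is a constant number
of operations of a real RAM. -/

/-- S-expressions over the reals. -/
inductive Val : Type
  | nil : Val
  | num (x : ℝ) : Val
  | cons (a b : Val) : Val

/-- Truth values: `nil` is false, everything else is true. -/
def Val.ofProp (q : Prop) [Decidable q] : Val := if q then Val.num 1 else Val.nil

/-- The primitive operations. -/
inductive Op : Type
  | id | nil | const (c : ℝ)
  | car | cdr | consp
  | add | sub | mul | div | le

/-- The (partial) effect of a primitive operation: `none` is a run-time error. -/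
def Op.apply : Op → Val → Option Val
  | .id, v => some v
  | .nil, _ => some .nil
  | .const c, _ => some (.num c)
  | .car, .cons a _ => some a
  | .cdr, .cons _ b => some b
  | .consp, .cons _ _ => some (.num 1)
  | .consp, _ => some .nil
  | .add, .cons (.num x) (.num y) => some (.num (x + y))
  | .sub, .cons (.num x) (.num y) => some (.num (x - y))
  | .mul, .cons (.num x) (.num y) => some (.num (x * y))
  | .div, .cons (.num x) (.num y) => open Classical in if y = 0 then none else some (.num (x / y))
  | .le, .cons (.num x) (.num y) => open Classical in some (Val.ofProp (x ≤ y))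
  | _, _ => none

/-- Programs; each maps an S-expression to an S-expression. -/
inductive Prog : Type
  /-- a primitive operation -/
  | op (o : Op) : Prog
  /-- `P` followed by `Q` -/
  | seq (P Q : Prog) : Prog
  /-- run both `P` and `Q` on the same argument and `cons` the results -/
  | fork (P Q : Prog) : Prog
  /-- if the test `T` is true of the argument, run `P` on it, otherwise `Q` -/
  | ite (T P Q : Prog) : Prog
  /-- as long as the test `T` is true of the current value, replace that value by means of `P` -/
  | loop (T P : Prog) : Prog

/-- `P.Run v w t`: on input `v`, the program `P` halts without error with output `w`
after exactly `t` steps. -/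
inductive Prog.Run : Prog → Val → Val → ℕ → Prop
  | op {o v w} : o.apply v = some w → Run (.op o) v w 1
  | seq {P Q u v w s t} : Run P u v s → Run Q v w t → Run (.seq P Q) u w (s + t + 1)
  | fork {P Q u v w s t} : Run P u v s → Run Q u w t → Run (.fork P Q) u (.cons v w) (s + t + 1)
  | ite_true {T P Q u b w s t} : Run T u b s → b ≠ .nil → Run P u w t →
      Run (.ite T P Q) u w (s + t + 1)
  | ite_false {T P Q u w s t} : Run T u .nil s → Run Q u w t → Run (.ite T P Q) u w (s + t + 1)
  | loop_done {T P u s} : Run T u .nil s → Run (.loop T P) u u (s + 1)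
  | loop_step {T P u b v w s t r} : Run T u b s → b ≠ .nil → Run P u v t →
      Run (.loop T P) v w r → Run (.loop T P) u w (s + t + r + 1)

/-- Programs are deterministic: the input determines the output and the number of steps. -/
theorem Prog.Run.deterministic {P : Prog} {u v w : Val} {s t : ℕ}
    (h₁ : P.Run u v s) (h₂ : P.Run u w t) : v = w ∧ s = t := by
  induction h₁ generalizing w t with
  | op h =>
    cases h₂ with
    | op h' => rw [h] at h'; exact ⟨Option.some.inj h', rfl⟩
  | seq _ _ ih₁ ih₂ =>
    cases h₂ with
    | seq a b =>
      obtain ⟨rfl, rfl⟩ := ih₁ a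
      obtain ⟨rfl, rfl⟩ := ih₂ b
      exact ⟨rfl, rfl⟩
  | fork _ _ ih₁ ih₂ =>
    cases h₂ with
    | fork a b =>
      obtain ⟨rfl, rfl⟩ := ih₁ a
      obtain ⟨rfl, rfl⟩ := ih₂ b
      exact ⟨rfl, rfl⟩
  | ite_true _ hb _ ih₁ ih₂ =>
    cases h₂ with
    | ite_true a _ b =>
      obtain ⟨rfl, rfl⟩ := ih₁ a
      obtain ⟨rfl, rfl⟩ := ih₂ b
      exact ⟨rfl, rfl⟩
    | ite_false a _ => exact absurd (ih₁ a).1 hb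
  | ite_false _ _ ih₁ ih₂ =>
    cases h₂ with
    | ite_true a hb _ => exact absurd (ih₁ a).1.symm hb
    | ite_false a b =>
      obtain ⟨_, rfl⟩ := ih₁ a
      obtain ⟨rfl, rfl⟩ := ih₂ b
      exact ⟨rfl, rfl⟩
  | loop_done _ ih =>
    cases h₂ with
    | loop_done a => obtain ⟨_, rfl⟩ := ih a; exact ⟨rfl, rfl⟩
    | loop_step a hb _ _ => exact absurd (ih a).1.symm hb
  | loop_step _ hb _ _ ih₁ ih₂ ih₃ =>
    cases h₂ with
    | loop_done a => exact absurd (ih₁ a).1 hb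
    | loop_step a _ b c =>
      obtain ⟨_, rfl⟩ := ih₁ a
      obtain ⟨rfl, rfl⟩ := ih₂ b
      obtain ⟨rfl, rfl⟩ := ih₃ c
      exact ⟨rfl, rfl⟩

/-! ### Encodings -/

/-- Lists, in the usual way. -/
def encList (l : List Val) : Val := l.foldr Val.cons Val.nil

/-- A complex number is the pair of its real and imaginary parts. -/
def encComplex (z : ℂ) : Val := Val.cons (Val.num z.re) (Val.num z.im)

/-- A graph on `{0, …, n - 1}` is given in adjacency list form: the list, over the vertices `v` in
increasing order, of the increasing lists of the neighbours of `v`. -/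
def encGraph {n : ℕ} (G : SimpleGraph (Fin n)) [DecidableRel G.Adj] : Val :=
  encList ((List.finRange n).map fun v =>
    encList (((List.finRange n).filter fun w => G.Adj v w).map fun w => Val.num ((w : ℕ) : ℝ)))

/-! ### Graph polynomials -/

/-- A multiplicative graph polynomial: it is `1` on the graph without vertices, and takes disjoint
unions to products. -/
def IsMultiplicative (p : GraphClass → ℂ[X]) : Prop :=
  p (isoClass (⊥ : SimpleGraph (Fin 0))) = 1 ∧
    ∀ (m n : ℕ) (G : SimpleGraph (Fin m)) (H : SimpleGraph (Fin n)),
      p (isoClass (SimpleGraph.sum G H)) = p (isoClass G) * p (isoClass H)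

/-- The program `A` computes `lam H i`, for all `i` and all graphs `H` with at most `α * i`
vertices, in time `O(β ^ |V(H)|)`. -/
def ComputesCoefficients (A : Prog) (lam : GraphClass → ℕ → ℂ) (α β : ℕ) : Prop :=
  ∃ K : ℕ, ∀ (k : ℕ) (H : SimpleGraph (Fin k)) [DecidableRel H.Adj] (i : ℕ), k ≤ α * i →
    ∃ t : ℕ, A.Run (Val.cons (encGraph H) (Val.num (i : ℝ))) (encComplex (lam (isoClass H) i)) t ∧
      t ≤ K * β ^ k

/-- Bounded induced graph counting polynomials. -/
structure IsBIGCP (p : GraphClass → ℂ[X]) : Prop where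
  multiplicative : IsMultiplicative p
  coeff_zero : ∀ H : GraphClass, (p H).coeff 0 = 1
  bounded : ∃ (α β : ℕ) (lam : GraphClass → ℕ → ℂ),
    (∀ (n : ℕ) (G : SimpleGraph (Fin n)) (i : ℕ),
      (p (isoClass G)).coeff i =
        ∑ H ∈ GraphClass.orderLE (α * i), lam H i * (ind H G : ℂ)) ∧
    ∃ A : Prog, ComputesCoefficients A lam α β

/-- The `j`-th inverse power sum `ζ₁⁻ʲ + ⋯ + ζ_d⁻ʲ` of a complex polynomial of degree `d` with
roots `ζ₁, …, ζ_d`, listed with multiplicity. -/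
def invPowerSum (q : ℂ[X]) (j : ℕ) : ℂ := (q.roots.map fun ζ => ζ⁻¹ ^ j).sum

end

/-! For a polynomial with constant term 1, Newton's identities (`invPowerSum_succ`) express the
inverse power sums through the coefficients, and the inverse power sums of a product add up. Regard
the power sum p_j(G[S]) as a function of the vertex set S. It has a unique expansion as the sum of
c(T) over the subsets T of S. The i-th coefficient of p(G[S]) only involves sets with at most αi
elements, and such degree bounds add under products, so Newton's identities give c(T) = 0 for |T| >
αj (`HasDegree.invPowerSum`). Additivity over disjoint unions gives c(T) = 0 whenever T splits into
two nonempty parts with no edge between them (`coeff_eq_zero_of_additive`). Hence p_j(G) is the sum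
of c(A) over connected sets A of size O(log(n/ε)).

For such an A, a computation of cost 2^{O(|A|)} is polynomial in n and n/ε (`polyBounded_pow_num`).
So c(A) is found by Möbius inversion over all subsets T of A (`altSum_empty`); each p_j(G[T]) comes
from Newton's recursion, and each coefficient from a sum of values λ over all small subsets of T.

The sets A come from a branching search that chooses or excludes one vertex per round, starting from
each possible largest element. A state stands for the total `weight` of the sets that contain the
chosen vertices and avoid the excluded ones, and branching preserves the sum of the weights
(`searchStep_inv`). When no neighbour is left to consider, every larger set of the state is
disconnected, so that the weight is c(A) (`SearchInv.weight_eq`). Bounded degree ends the search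
after Δs rounds, where s bounds the number of chosen vertices, so there are at most 2^{O(s)}n states
(`search_done`, `length_search_le`).

Running times are tracked by the judgement `PolyTime`, which has one rule for each program
constructor. The rules for conditionals, loops and folds only ask about the states that actually
occur, so size bounds proved for the mathematical functions carry over to the programs. -/

noncomputable section

/-! ### Polynomially bounded families -/

/-- The family `t` is bounded by a polynomial in the size `M`. -/
def PolyBounded {ι : Type} (M t : ι → ℕ) : Prop := ∃ c : ℕ, ∀ i, t i ≤ (M i + 2) ^ c

namespace PolyBounded

variable {ι κ : Type} {M s t : ι → ℕ}

theorem mono (h : PolyBounded M t) (hst : ∀ i, s i ≤ t i) : PolyBounded M s :=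
  h.imp fun _ hc i => (hst i).trans (hc i)

theorem comap (h : PolyBounded M t) (g : κ → ι) :
    PolyBounded (fun k => M (g k)) (fun k => t (g k)) :=
  h.imp fun _ hc k => hc (g k)

theorem size : PolyBounded M M := ⟨1, fun i => by simp⟩

theorem const (c : ℕ) : PolyBounded M (fun _ => c) :=
  ⟨c, fun i => (Nat.lt_two_pow_self).le.trans (Nat.pow_le_pow_left (by omega) c)⟩

theorem add (hs : PolyBounded M s) (ht : PolyBounded M t) :
    PolyBounded M (fun i => s i + t i) := by
  obtain ⟨a, ha⟩ := hs
  obtain ⟨b, hb⟩ := ht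
  -- The base is at least 2, so one more power absorbs the factor 2 in twice the larger summand.
  refine ⟨max a b + 1, fun i => ?_⟩
  have h1 : (M i + 2) ^ a ≤ (M i + 2) ^ max a b :=
    Nat.pow_le_pow_right (by omega) (le_max_left _ _)
  have h2 : (M i + 2) ^ b ≤ (M i + 2) ^ max a b :=
    Nat.pow_le_pow_right (by omega) (le_max_right _ _)
  have h3 := ha i
  have h4 := hb i
  rw [pow_succ]
  nlinarith

theorem mul (hs : PolyBounded M s) (ht : PolyBounded M t) :
    PolyBounded M (fun i => s i * t i) := by
  obtain ⟨a, ha⟩ := hs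
  obtain ⟨b, hb⟩ := ht
  exact ⟨a + b, fun i => by rw [pow_add]; exact Nat.mul_le_mul (ha i) (hb i)⟩

end PolyBounded

/-! ### Typed data -/

/-- Types whose elements are represented by S-expressions. -/
class Enc (X : Type) where
  /-- the representation -/
  enc : X → Val

open Enc (enc)

instance : Enc Bool := ⟨fun b => if b then .num 1 else .nil⟩
instance : Enc ℝ := ⟨.num⟩
instance : Enc ℕ := ⟨fun n => .num n⟩
instance : Enc ℂ := ⟨encComplex⟩
instance {X Y : Type} [Enc X] [Enc Y] : Enc (X × Y) := ⟨fun p => .cons (enc p.1) (enc p.2)⟩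
instance {X : Type} [Enc X] : Enc (List X) := ⟨fun l => encList (l.map enc)⟩

/-! ### Programs that run in polynomial time on a family of inputs -/

/-- On the family `u` of inputs, the program `P` computes the family `x` in time polynomial in the
size `M`. -/
def PolyTime {ι Γ X : Type} [Enc Γ] [Enc X] (M : ι → ℕ) (P : Prog) (u : ι → Γ) (x : ι → X) :
    Prop :=
  ∃ b : ι → ℕ, PolyBounded M b ∧ ∀ i, ∃ t ≤ b i, P.Run (enc (u i)) (enc (x i)) t

/-- The states `s j` and test values `e j` are prescribed in advance, so the number of rounds is
known and per-round bounds just multiply. The factor `N + 1` includes the final, failing test. -/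
theorem Prog.Run.iterate {T P : Prog} {a b : ℕ} :
    ∀ (N : ℕ) (s : ℕ → Val) (e : ℕ → Val),
    (∀ j < N, e j ≠ .nil ∧ (∃ t ≤ a, T.Run (s j) (e j) t) ∧ ∃ t ≤ b, P.Run (s j) (s (j + 1)) t) →
    (∃ t ≤ a, T.Run (s N) .nil t) →
    ∃ t ≤ (N + 1) * (a + b + 1), (Prog.loop T P).Run (s 0) (s N) t
  | 0, s, e, _, ⟨t, ht, h⟩ => ⟨t + 1, by omega, .loop_done h⟩
  | N + 1, s, e, hs, hN => by
    obtain ⟨hne, ⟨t₁, ht₁, h₁⟩, t₂, ht₂, h₂⟩ := hs 0 (by omega)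
    obtain ⟨t₃, ht₃, h₃⟩ := Prog.Run.iterate N (fun j => s (j + 1)) (fun j => e (j + 1))
      (fun j hj => hs (j + 1) (by omega)) hN
    refine ⟨t₁ + t₂ + t₃ + 1, ?_, .loop_step h₁ hne h₂ h₃⟩
    have : (N + 1 + 1) * (a + b + 1) = (N + 1) * (a + b + 1) + (a + b + 1) := by ring
    omega

/-- The first component of a pair. -/
def Prog.car : Prog := .op .car

/-- The second component of a pair. -/
def Prog.cdr : Prog := .op .cdr

/-- Run `P`, push its value onto the environment, and run `Q`. -/
def Prog.bind (P Q : Prog) : Prog := .seq (.fork P (.op .id)) Q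

/-- The index of an element of one of the lists of a family. -/
structure MemIdx {ι X : Type} (l : ι → List X) : Type where
  i : ι
  x : X
  mem : x ∈ l i

/-- The index of a position in one of the lists of a family. -/
structure PosIdx {ι X : Type} (l : ι → List X) : Type where
  i : ι
  pre : List X
  x : X
  pos : ∃ s, l i = pre ++ x :: s

/-- The index of a round of a loop. -/
structure LtIdx {ι : Type} (N : ι → ℕ) : Type where
  i : ι
  j : ℕ
  lt : j < N i

namespace PolyTime

variable {ι κ Γ Γ' X Y Z : Type} [Enc Γ] [Enc Γ'] [Enc X] [Enc Y] [Enc Z] {M : ι → ℕ}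
  {P Q T : Prog} {u : ι → Γ}

theorem congr {x y : ι → X} (h : PolyTime M P u x) (hxy : ∀ i, x i = y i) : PolyTime M P u y := by
  rwa [← funext hxy]

theorem comap {x : ι → X} (h : PolyTime M P u x) (g : κ → ι) :
    PolyTime (fun k => M (g k)) P (fun k => u (g k)) (fun k => x (g k)) := by
  obtain ⟨b, hb, h⟩ := h
  exact ⟨_, hb.comap g, fun k => h (g k)⟩

theorem op {o : Op} {x : ι → X} (h : ∀ i, o.apply (enc (u i)) = some (enc (x i))) :
    PolyTime M (.op o) u x :=
  ⟨fun _ => 1, .const 1, fun i => ⟨1, le_rfl, .op (h i)⟩⟩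

theorem id : PolyTime M (.op .id) u u := op fun _ => rfl

theorem seq {x : ι → X} {y : ι → Y} (hP : PolyTime M P u x) (hQ : PolyTime M Q x y) :
    PolyTime M (.seq P Q) u y := by
  obtain ⟨a, ha, hP⟩ := hP
  obtain ⟨b, hb, hQ⟩ := hQ
  refine ⟨_, (ha.add hb).add (.const 1), fun i => ?_⟩
  obtain ⟨s, hs, hP⟩ := hP i
  obtain ⟨t, ht, hQ⟩ := hQ i
  exact ⟨_, by omega, .seq hP hQ⟩

theorem fork {x : ι → X} {y : ι → Y} (hP : PolyTime M P u x) (hQ : PolyTime M Q u y) :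
    PolyTime M (.fork P Q) u (fun i => (x i, y i)) := by
  obtain ⟨a, ha, hP⟩ := hP
  obtain ⟨b, hb, hQ⟩ := hQ
  refine ⟨_, (ha.add hb).add (.const 1), fun i => ?_⟩
  obtain ⟨s, hs, hP⟩ := hP i
  obtain ⟨t, ht, hQ⟩ := hQ i
  exact ⟨_, by omega, .fork hP hQ⟩

theorem bind {x : ι → X} {y : ι → Y} (hP : PolyTime M P u x)
    (hQ : PolyTime M Q (fun i => (x i, u i)) y) : PolyTime M (P.bind Q) u y :=
  (hP.fork id).seq hQ

theorem car {x : ι → X} {v : ι → Γ} : PolyTime M .car (fun i => (x i, v i)) x := op fun _ => rfl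
theorem cdr {x : ι → X} {v : ι → Γ} : PolyTime M .cdr (fun i => (x i, v i)) v := op fun _ => rfl

/-- Each branch is examined only on the inputs that select it, because it may fail on the others.
The cost functions of the branches live on subfamilies, so the total is built from the polynomials
that bound them. -/
theorem ite {b : ι → Bool} {x : ι → X} (hT : PolyTime M T u b)
    (hP : PolyTime (fun i : {i // b i = true} => M i) P (fun i => u i) (fun i => x i))
    (hQ : PolyTime (fun i : {i // b i = false} => M i) Q (fun i => u i) (fun i => x i)) :
    PolyTime M (.ite T P Q) u x := by
  obtain ⟨a, ⟨ca, ha⟩, hT⟩ := hT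
  obtain ⟨p, ⟨cp, hp⟩, hP⟩ := hP
  obtain ⟨q, ⟨cq, hq⟩, hQ⟩ := hQ
  refine ⟨fun i => (M i + 2) ^ ca + (M i + 2) ^ cp + (M i + 2) ^ cq + 1,
    (((PolyBounded.add ⟨ca, fun _ => le_rfl⟩ ⟨cp, fun _ => le_rfl⟩).add
      ⟨cq, fun _ => le_rfl⟩).add (.const 1)), fun i => ?_⟩
  obtain ⟨s, hs, hT⟩ := hT i
  have := ha i
  cases hb : b i with
  | true =>
    obtain ⟨t, ht, hP⟩ := hP ⟨i, hb⟩
    have := hp ⟨i, hb⟩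
    refine ⟨s + t + 1, by dsimp only at *; omega, .ite_true hT ?_ hP⟩
    simp [hb, enc]
  | false =>
    obtain ⟨t, ht, hQ⟩ := hQ ⟨i, hb⟩
    have := hq ⟨i, hb⟩
    refine ⟨s + t + 1, by dsimp only at *; omega, .ite_false ?_ hQ⟩
    simpa [hb, enc] using hT

/-- Conditionals whose branches run without error whatever the test says. -/
theorem cond {b : ι → Bool} {x y : ι → X} (hT : PolyTime M T u b) (hP : PolyTime M P u x)
    (hQ : PolyTime M Q u y) : PolyTime M (.ite T P Q) u (fun i => if b i then x i else y i) :=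
  ite hT ((hP.comap Subtype.val).congr fun i => by simp [i.2])
    ((hQ.comap Subtype.val).congr fun i => by simp [i.2])

/-- Making the round number part of the index turns uniformity over rounds into a single `PolyTime`
statement. The test is run once more than the body, hence `N i + 1` in its index. -/
theorem loop {S : Type} [Enc S] {N : ι → ℕ} (hN : PolyBounded M N) (s : ι → ℕ → S)
    (hT : PolyTime (fun j : LtIdx (fun i => N i + 1) => M j.i) T (fun j => s j.i j.j)
      (fun j => decide (j.j < N j.i)))
    (hP : PolyTime (fun j : LtIdx N => M j.i) P (fun j => s j.i j.j) (fun j => s j.i (j.j + 1))) :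
    PolyTime M (.loop T P) (fun i => s i 0) (fun i => s i (N i)) := by
  obtain ⟨a, ⟨ca, ha⟩, hT⟩ := hT
  obtain ⟨p, ⟨cp, hp⟩, hP⟩ := hP
  refine ⟨fun i => (N i + 1) * ((M i + 2) ^ ca + (M i + 2) ^ cp + 1),
    (hN.add (.const 1)).mul ((PolyBounded.add ⟨ca, fun _ => le_rfl⟩
      ⟨cp, fun _ => le_rfl⟩).add (.const 1)), fun i => ?_⟩
  refine Prog.Run.iterate (N i) (fun j => enc (s i j)) (fun j => enc (decide (j < N i))) ?_ ?_
  · intro j hj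
    refine ⟨by simp [enc, hj], ?_, ?_⟩
    · obtain ⟨t, ht, h⟩ := hT ⟨i, j, by omega⟩
      exact ⟨t, ht.trans (ha _), h⟩
    · obtain ⟨t, ht, h⟩ := hP ⟨i, j, hj⟩
      exact ⟨t, ht.trans (hp _), h⟩
  · obtain ⟨t, ht, h⟩ := hT ⟨i, N i, by omega⟩
    exact ⟨t, ht.trans (ha _), by simpa [enc] using h⟩

end PolyTime

/-! ### A library of list programs -/

namespace Prog

/-- The program with a given constant value. -/
def quote : Val → Prog
  | .nil => .op .nil
  | .num c => .op (.const c)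
  | .cons a b => .fork (quote a) (quote b)

/-- Fold the program `B` over the list `L`, from the initial value `A`. The argument of `B` is the
element, followed by the accumulated value and the environment. -/
def fold (L A B : Prog) : Prog :=
  .seq (.fork L (.fork A (.op .id))) <|
    .seq (.loop (.seq car (.op .consp))
      (.fork (.seq car cdr) (.fork (.seq (.fork (.seq car car) cdr) B) (.seq cdr cdr))))
    (.seq cdr car)

/-- The variable with a given position in the environment. -/
def var : ℕ → Prog
  | 0 => car
  | k + 1 => .seq cdr (var k)

/-- The environment without its first entries. -/
def env : ℕ → Prog
  | 0 => .op .id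
  | k + 1 => .seq cdr (env k)

/-- Apply a program to the values of two others. -/
def app₂ (F P Q : Prog) : Prog := .seq (.fork P Q) F

def reverse : Prog := fold (.op .id) (quote .nil) (.fork (var 0) (var 1))

/-- Concatenation of a pair of lists. -/
def append : Prog := fold (.seq car reverse) cdr (.fork (var 0) (var 1))

/-- Concatenate the lists that `B` computes from the elements of `L`. -/
def flatMap (L B : Prog) : Prog :=
  fold (.seq L reverse) (quote .nil) (app₂ append (.seq (.fork (var 0) (env 2)) B) (var 1))

def map (L B : Prog) : Prog := flatMap L (.fork B (quote .nil))

/-- The elements of `L` with the property `B`. -/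
def filter (L B : Prog) : Prog := flatMap L (.ite B (.fork (var 0) (quote .nil)) (quote .nil))

end Prog

theorem List.foldl_flip_cons {X : Type} (l m : List X) :
    l.foldl (fun m x => x :: m) m = l.reverse ++ m := by
  induction l generalizing m with
  | nil => rfl
  | cons x l ih => simp [ih]

/-- Blocks are put in front of the accumulator, so that each concatenation costs only the length of
the new block; the list is therefore traversed backwards. -/
theorem List.foldl_append_flatMap {X Y : Type} (f : X → List Y) (l : List X) (m : List Y) :
    l.reverse.foldl (fun m x => f x ++ m) m = l.flatMap f ++ m := by
  induction l generalizing m with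
  | nil => rfl
  | cons x l ih => simp [ih]

namespace PolyTime

variable {ι κ Γ Γ' X Y Z : Type} [Enc Γ] [Enc Γ'] [Enc X] [Enc Y] [Enc Z] {M : ι → ℕ}
  {P Q T L A B : Prog} {u : ι → Γ}

theorem run_quote (v : Val) : ∃ b, ∀ w, ∃ t ≤ b, (Prog.quote v).Run w v t := by
  induction v with
  | nil => exact ⟨1, fun _ => ⟨1, le_rfl, .op rfl⟩⟩
  | num c => exact ⟨1, fun _ => ⟨1, le_rfl, .op rfl⟩⟩
  | cons a b iha ihb =>
    obtain ⟨s, hs⟩ := iha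
    obtain ⟨t, ht⟩ := ihb
    refine ⟨s + t + 1, fun w => ?_⟩
    obtain ⟨s', hs', ha⟩ := hs w
    obtain ⟨t', ht', hb⟩ := ht w
    exact ⟨_, by omega, .fork ha hb⟩

theorem quote (x : X) : PolyTime M (.quote (enc x)) u (fun _ => x) := by
  obtain ⟨b, hb⟩ := run_quote (enc x)
  exact ⟨fun _ => b, .const b, fun i => hb _⟩

theorem nil : PolyTime M (.quote .nil) u (fun _ => ([] : List X)) := quote []

theorem cons {x : ι → X} {l : ι → List X} (hP : PolyTime M P u x) (hQ : PolyTime M Q u l) :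
    PolyTime M (.fork P Q) u (fun i => x i :: l i) :=
  hP.fork hQ

theorem consp {l : ι → List X} : PolyTime M (.op .consp) l (fun i => !(l i).isEmpty) := by
  refine op fun i => ?_
  cases l i <;> rfl

theorem head {l l' : ι → List X} {x : ι → X} (h : ∀ i, l i = x i :: l' i) :
    PolyTime M .car l x := op fun i => by rw [h i]; rfl

theorem tail {l l' : ι → List X} {x : ι → X} (h : ∀ i, l i = x i :: l' i) :
    PolyTime M .cdr l l' := op fun i => by rw [h i]; rfl

/-- The body is tested only on accumulators obtained by folding a prefix of the list. Invariants of
the fold may therefore be used to bound the cost of its body. -/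
theorem fold {l : ι → List X} {a : ι → Y} (f : ι → Y → X → Y) (hL : PolyTime M L u l)
    (hA : PolyTime M A u a) (hl : PolyBounded M fun i => (l i).length)
    (hB : PolyTime (fun j : PosIdx l => M j.i) B
      (fun j => (j.x, j.pre.foldl (f j.i) (a j.i), u j.i))
      (fun j => f j.i (j.pre.foldl (f j.i) (a j.i)) j.x)) :
    PolyTime M (.fold L A B) u (fun i => (l i).foldl (f i) (a i)) := by
  refine (hL.fork (hA.fork id)).seq (seq (x := fun i => (([] : List X),
    (l i).foldl (f i) (a i), u i)) ?_ (cdr.seq car))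
  have := loop (M := M) (T := .seq .car (.op .consp))
    (P := .fork (.seq .car .cdr) (.fork (.seq (.fork (.seq .car .car) .cdr) B) (.seq .cdr .cdr)))
    (N := fun i => (l i).length) hl
    (fun i j => ((l i).drop j, ((l i).take j).foldl (f i) (a i), u i))
    ((car.seq consp).congr fun j => ?_) ?_
  · simpa using this
  · rw [Bool.eq_iff_iff]
    simp
  -- Round `j` handles the element behind the prefix of length `j`.
  · let g : LtIdx (fun i => (l i).length) → PosIdx l := fun j =>
      ⟨j.i, (l j.i).take j.j, (l j.i)[j.j]'j.lt, (l j.i).drop (j.j + 1), by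
        rw [List.cons_getElem_drop_succ, List.take_append_drop]⟩
    have hd : ∀ j : LtIdx (fun i => (l i).length),
        (l j.i).drop j.j = (l j.i)[j.j]'j.lt :: (l j.i).drop (j.j + 1) := fun j =>
      (List.cons_getElem_drop_succ ..).symm
    refine fork (car.seq (tail hd)) (fork (((car.seq (head hd)).fork cdr).seq
      ((hB.comap g).congr fun j => ?_)) (cdr.seq cdr))
    have hlt : j.j < (l j.i).length := j.lt
    rw [List.take_add_one, List.getElem?_eq_getElem hlt]
    simp only [g, List.foldl_append, Option.toList, List.foldl_cons, List.foldl_nil]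

theorem var_zero {x : ι → X} {v : ι → Γ} : PolyTime M (.var 0) (fun i => (x i, v i)) x := car

theorem var_succ {y : ι → Y} {x : ι → X} {v : ι → Γ} {k : ℕ} (h : PolyTime M (.var k) v y) :
    PolyTime M (.var (k + 1)) (fun i => (x i, v i)) y := cdr.seq h

theorem env_zero : PolyTime M (.env 0) u u := id

theorem env_succ {y : ι → Y} {x : ι → X} {v : ι → Γ} {k : ℕ} (h : PolyTime M (.env k) v y) :
    PolyTime M (.env (k + 1)) (fun i => (x i, v i)) y := cdr.seq h

theorem var₁ {x₀ : ι → X} {x : ι → Y} {v : ι → Γ} :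
    PolyTime M (.var 1) (fun i => (x₀ i, x i, v i)) x := var_succ var_zero

theorem app₂ {F : Prog} {x : ι → X} {y : ι → Y} {z : ι → Z}
    (hF : PolyTime M F (fun i => (x i, y i)) z) (hP : PolyTime M P u x) (hQ : PolyTime M Q u y) :
    PolyTime M (.app₂ F P Q) u z := (hP.fork hQ).seq hF

theorem reverse {l : ι → List X} (hl : PolyBounded M fun i => (l i).length) :
    PolyTime M .reverse l (fun i => (l i).reverse) :=
  (fold (fun _ m x => x :: m) id nil hl (cons var_zero var₁)).congr fun i => by
    rw [List.foldl_flip_cons]; simp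

theorem append {l m : ι → List X} (hl : PolyBounded M fun i => (l i).length) :
    PolyTime M .append (fun i => (l i, m i)) (fun i => l i ++ m i) :=
  (fold (fun _ m x => x :: m) (car.seq (reverse hl)) cdr (by simpa using hl)
    (cons var_zero var₁)).congr fun i => by
    rw [List.foldl_flip_cons]; simp

theorem flatMap {l : ι → List X} {f : ι → X → List Y} (hL : PolyTime M L u l)
    (hl : PolyBounded M fun i => (l i).length)
    (hf : PolyBounded (fun j : MemIdx l => M j.i) fun j => (f j.i j.x).length)
    (hB : PolyTime (fun j : MemIdx l => M j.i) B (fun j => (j.x, u j.i)) (fun j => f j.i j.x)) :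
    PolyTime M (.flatMap L B) u (fun i => (l i).flatMap (f i)) := by
  -- The order of traversal is irrelevant to the body, so membership is all that is kept of a
  -- position.
  let g : PosIdx (fun i => (l i).reverse) → MemIdx l := fun j =>
    ⟨j.i, j.x, by
      obtain ⟨s, hs⟩ := j.pos
      rw [← List.mem_reverse, hs]
      simp⟩
  refine (fold (fun i m x => f i x ++ m) (hL.seq (reverse hl)) nil (by simpa using hl)
    (app₂ (append (hf.comap g)) ((fork var_zero (env_succ (env_succ env_zero))).seq
      (hB.comap g)) var₁)).congr fun i => ?_
  rw [List.foldl_append_flatMap]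
  simp

theorem map {l : ι → List X} {f : ι → X → Y} (hL : PolyTime M L u l)
    (hl : PolyBounded M fun i => (l i).length)
    (hB : PolyTime (fun j : MemIdx l => M j.i) B (fun j => (j.x, u j.i)) (fun j => f j.i j.x)) :
    PolyTime M (.map L B) u (fun i => (l i).map (f i)) :=
  (flatMap (f := fun i x => [f i x]) hL hl (.const 1) (hB.cons nil)).congr fun i => by
    induction l i with
    | nil => rfl
    | cons x m ih => rw [List.flatMap_cons, ih]; rfl

theorem filter {l : ι → List X} {f : ι → X → Bool} (hL : PolyTime M L u l)
    (hl : PolyBounded M fun i => (l i).length)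
    (hB : PolyTime (fun j : MemIdx l => M j.i) B (fun j => (j.x, u j.i)) (fun j => f j.i j.x)) :
    PolyTime M (.filter L B) u (fun i => (l i).filter (f i)) :=
  (flatMap (f := fun i x => if f i x then [x] else []) hL hl
    ((PolyBounded.const 1).mono fun j => by split <;> simp)
    (cond hB (cons var_zero nil) nil)).congr fun i => by
    induction l i with
    | nil => rfl
    | cons x m ih => rw [List.flatMap_cons, ih, List.filter_cons]; split <;> simp

end PolyTime

/-! ### Programs for numbers, indexing and complex arithmetic -/

namespace Prog

/-- Equality of two real numbers. -/
def eqNum : Prog := .ite (.op .le) (.seq (.fork cdr car) (.op .le)) (quote .nil)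

/-- Negation of a truth value. -/
def not (P : Prog) : Prog := .ite P (quote .nil) (quote (.num 1))

/-- Whether the number `x` occurs in the list `l`, on input `(x, l)`. -/
def mem : Prog :=
  fold cdr (quote .nil) (.ite (app₂ eqNum (var 0) (var 2)) (quote (.num 1)) (var 1))

/-- The entry number `k` of the list `l`, or else `d`, on input `(d, k, l)`. -/
def getD : Prog :=
  .seq (fold (env 2) (.fork (quote (.num 0)) car)
    (.fork (app₂ (.op .add) (.seq (var 1) car) (quote (.num 1)))
      (.ite (app₂ eqNum (.seq (var 1) car) (var 3)) (var 0) (.seq (var 1) cdr)))) cdr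

/-- The length of a list. -/
def length : Prog :=
  fold (.op .id) (quote (.num 0)) (app₂ (.op .add) (var 1) (quote (.num 1)))

/-- The positions of the entries of a list. -/
def positions : Prog :=
  .seq (fold (.op .id) (.fork (quote (.num 0)) (quote .nil))
    (.fork (app₂ (.op .add) (.seq (var 1) car) (quote (.num 1)))
      (app₂ append (.seq (var 1) cdr) (.fork (.seq (var 1) car) (quote .nil))))) cdr

/-- Addition of complex numbers. -/
def addComplex : Prog :=
  .fork (app₂ (.op .add) (.seq car car) (.seq cdr car))
    (app₂ (.op .add) (.seq car cdr) (.seq cdr cdr))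

/-- Multiplication of complex numbers. -/
def mulComplex : Prog :=
  .fork
    (app₂ (.op .sub) (app₂ (.op .mul) (.seq car car) (.seq cdr car))
      (app₂ (.op .mul) (.seq car cdr) (.seq cdr cdr)))
    (app₂ (.op .add) (app₂ (.op .mul) (.seq car car) (.seq cdr cdr))
      (app₂ (.op .mul) (.seq car cdr) (.seq cdr car)))

/-- The sum of a list of complex numbers. -/
def sumComplex : Prog :=
  fold (.op .id) (quote (enc (0 : ℂ))) (app₂ addComplex (var 1) (var 0))

end Prog

theorem List.foldl_decide_mem (x : ℕ) (l : List ℕ) (b : Bool) :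
    l.foldl (fun b y => if decide (y = x) then true else b) b = (decide (x ∈ l) || b) := by
  induction l generalizing b with
  | nil => simp
  | cons y l ih =>
    rw [List.foldl_cons, ih]
    by_cases h : y = x
    · subst h; simp
    · have h' : x ≠ y := fun e => h e.symm
      simp [h, h']

/-- The counter equals `k` at most once; by `aux` the stored value is frozen after that, and if it
never happens the default survives. -/
theorem List.foldl_getD {X : Type} (k : ℕ) (l : List X) (c : ℕ) (r : X) (hc : c ≤ k) :
    (l.foldl (fun (s : ℕ × X) y => (s.1 + 1, if decide (s.1 = k) then y else s.2)) (c, r)).2 =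
      l.getD (k - c) r := by
  have aux : ∀ (l : List X) (c : ℕ) (r : X), k < c →
      (l.foldl (fun (s : ℕ × X) y =>
        (s.1 + 1, if decide (s.1 = k) then y else s.2)) (c, r)).2 = r := by
    intro l
    induction l with
    | nil => intros; rfl
    | cons y l ih =>
      intro c r hc
      rw [List.foldl_cons, ih _ _ (by dsimp only; omega)]
      simp [hc.ne']
  induction l generalizing c r with
  | nil => rfl
  | cons y l ih =>
    rw [List.foldl_cons]
    rcases hc.eq_or_lt with rfl | hlt
    · rw [aux _ _ _ (by dsimp only; omega)]
      simp
    · rw [ih _ _ (by dsimp only; omega)]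
      obtain ⟨d, rfl⟩ := Nat.exists_eq_add_of_lt hlt
      have h1 : c + d + 1 - c = d + 1 := by omega
      have h2 : c + d + 1 - (c + 1) = d := by omega
      have h3 : c ≠ c + d + 1 := by omega
      simp [h1, h2, h3]

theorem List.foldl_length {X : Type} (l : List X) (c : ℕ) :
    l.foldl (fun n _ => n + 1) c = c + l.length := by
  induction l generalizing c with
  | nil => rfl
  | cons x l ih => rw [List.foldl_cons, ih, List.length_cons]; omega

theorem List.foldl_positions {X : Type} (l : List X) (c : ℕ) :
    l.foldl (fun (s : ℕ × List ℕ) _ => (s.1 + 1, s.2 ++ [s.1])) (c, List.range c) =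
      (c + l.length, List.range (c + l.length)) := by
  induction l generalizing c with
  | nil => rfl
  | cons x l ih =>
    rw [List.foldl_cons, ← List.range_succ, ih, List.length_cons, add_assoc, add_comm 1]

namespace PolyTime

variable {ι κ Γ Γ' X Y Z : Type} [Enc Γ] [Enc Γ'] [Enc X] [Enc Y] [Enc Z] {M : ι → ℕ}
  {P Q T L A B : Prog} {u : ι → Γ}

theorem quote_nat (k : ℕ) : PolyTime M (.quote (.num k)) u (fun _ => k) := quote k

theorem quote_zero : PolyTime M (.quote (.num 0)) u (fun _ => 0) := by
  simpa using quote_nat (M := M) (u := u) 0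

theorem quote_one : PolyTime M (.quote (.num 1)) u (fun _ => 1) := by
  simpa using quote_nat (M := M) (u := u) 1

theorem quote_true : PolyTime M (.quote (.num 1)) u (fun _ => true) := quote true

theorem quote_false : PolyTime M (.quote .nil) u (fun _ => false) := quote false

theorem var₂ {X₀ X₁ : Type} [Enc X₀] [Enc X₁] {x₀ : ι → X₀} {x₁ : ι → X₁} {x : ι → Y} {v : ι → Γ} :
    PolyTime M (.var 2) (fun i => (x₀ i, x₁ i, x i, v i)) x := var_succ var₁

theorem var₃ {X₀ X₁ X₂ : Type} [Enc X₀] [Enc X₁] [Enc X₂] {x₀ : ι → X₀} {x₁ : ι → X₁} {x₂ : ι → X₂}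
    {x : ι → Y} {v : ι → Γ} :
    PolyTime M (.var 3) (fun i => (x₀ i, x₁ i, x₂ i, x i, v i)) x := var_succ var₂

theorem var₄ {X₀ X₁ X₂ X₃ : Type} [Enc X₀] [Enc X₁] [Enc X₂] [Enc X₃] {x₀ : ι → X₀} {x₁ : ι → X₁}
    {x₂ : ι → X₂} {x₃ : ι → X₃} {x : ι → Y} {v : ι → Γ} :
    PolyTime M (.var 4) (fun i => (x₀ i, x₁ i, x₂ i, x₃ i, x i, v i)) x := var_succ var₃

theorem var₅ {X₀ X₁ X₂ X₃ X₄ : Type} [Enc X₀] [Enc X₁] [Enc X₂] [Enc X₃] [Enc X₄] {x₀ : ι → X₀}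
    {x₁ : ι → X₁} {x₂ : ι → X₂} {x₃ : ι → X₃} {x₄ : ι → X₄} {x : ι → Y} {v : ι → Γ} :
    PolyTime M (.var 5) (fun i => (x₀ i, x₁ i, x₂ i, x₃ i, x₄ i, x i, v i)) x := var_succ var₄

theorem env₁ {X₀ : Type} [Enc X₀] {x₀ : ι → X₀} {v : ι → Γ} :
    PolyTime M (.env 1) (fun i => (x₀ i, v i)) v := env_succ env_zero

theorem env₂ {X₀ X₁ : Type} [Enc X₀] [Enc X₁] {x₀ : ι → X₀} {x₁ : ι → X₁} {v : ι → Γ} :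
    PolyTime M (.env 2) (fun i => (x₀ i, x₁ i, v i)) v := env_succ env₁

theorem env₃ {X₀ X₁ X₂ : Type} [Enc X₀] [Enc X₁] [Enc X₂] {x₀ : ι → X₀} {x₁ : ι → X₁} {x₂ : ι → X₂}
    {v : ι → Γ} : PolyTime M (.env 3) (fun i => (x₀ i, x₁ i, x₂ i, v i)) v := env_succ env₂

theorem le_real {x y : ι → ℝ} :
    PolyTime M (.op .le) (fun i => (x i, y i)) (fun i => decide (x i ≤ y i)) := op fun i => by
  by_cases h : x i ≤ y i <;> simp [enc, Op.apply, Val.ofProp, h]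

theorem le_nat {x y : ι → ℕ} :
    PolyTime M (.op .le) (fun i => (x i, y i)) (fun i => decide (x i ≤ y i)) := op fun i => by
  by_cases h : x i ≤ y i <;> simp [enc, Op.apply, Val.ofProp, h]

theorem add_real {x y : ι → ℝ} :
    PolyTime M (.op .add) (fun i => (x i, y i)) (fun i => x i + y i) := op fun _ => rfl

theorem sub_real {x y : ι → ℝ} :
    PolyTime M (.op .sub) (fun i => (x i, y i)) (fun i => x i - y i) := op fun _ => rfl

theorem mul_real {x y : ι → ℝ} :
    PolyTime M (.op .mul) (fun i => (x i, y i)) (fun i => x i * y i) := op fun _ => rfl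

theorem add_nat {x y : ι → ℕ} :
    PolyTime M (.op .add) (fun i => (x i, y i)) (fun i => x i + y i) := op fun i => by
  simp [enc, Op.apply]

theorem mul_nat {x y : ι → ℕ} :
    PolyTime M (.op .mul) (fun i => (x i, y i)) (fun i => x i * y i) := op fun i => by
  simp [enc, Op.apply]

theorem eqNum {x y : ι → ℕ} :
    PolyTime M .eqNum (fun i => (x i, y i)) (fun i => decide (x i = y i)) :=
  (cond le_nat (app₂ le_nat cdr car) quote_false).congr fun i => by
    rw [Bool.eq_iff_iff]
    by_cases h : x i ≤ y i
    · simpa [h] using ⟨fun h' => le_antisymm h h', fun e => e.ge⟩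
    · simpa [h] using fun e : x i = y i => h e.le

theorem not {b : ι → Bool} (h : PolyTime M P u b) : PolyTime M (.not P) u (fun i => !b i) :=
  (cond h quote_false quote_true).congr fun i => by cases b i <;> rfl

theorem mem {x : ι → ℕ} {l : ι → List ℕ} (hl : PolyBounded M fun i => (l i).length) :
    PolyTime M .mem (fun i => (x i, l i)) (fun i => decide (x i ∈ l i)) :=
  (fold (fun i b y => if decide (y = x i) then true else b) cdr quote_false hl
    (cond (app₂ eqNum var_zero var₂) quote_true var₁)).congr fun i => by
    rw [List.foldl_decide_mem, Bool.or_false]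

theorem getD {d : ι → X} {k : ι → ℕ} {l : ι → List X} (hl : PolyBounded M fun i => (l i).length) :
    PolyTime M .getD (fun i => (d i, k i, l i)) (fun i => (l i).getD (k i) (d i)) :=
  (seq (fold (fun i (s : ℕ × X) y => (s.1 + 1, if decide (s.1 = k i) then y else s.2)) env₂
    (quote_zero.fork car) hl
    (fork (app₂ add_nat (var₁.seq car) quote_one)
      (cond (app₂ eqNum (var₁.seq car) var₃) var_zero (var₁.seq cdr)))) cdr).congr fun i =>
    List.foldl_getD (k i) (l i) 0 (d i) (Nat.zero_le _)

theorem length {l : ι → List X} (hl : PolyBounded M fun i => (l i).length) :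
    PolyTime M .length l (fun i => (l i).length) :=
  (fold (fun _ n _ => n + 1) id quote_zero hl (app₂ add_nat var₁ quote_one)).congr fun i => by
    rw [List.foldl_length, Nat.zero_add]

theorem positions {l : ι → List X} (hl : PolyBounded M fun i => (l i).length) :
    PolyTime M .positions l (fun i => List.range (l i).length) := by
  refine (seq (fold (fun _ (s : ℕ × List ℕ) _ => (s.1 + 1, s.2 ++ [s.1])) id
    (quote_zero.fork nil) hl (fork (app₂ add_nat (var₁.seq car) quote_one)
      (app₂ (append ?_) (var₁.seq cdr) (cons (var₁.seq car) nil)))) cdr).congr fun i => ?_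
  · refine (hl.comap PosIdx.i).mono fun j => ?_
    obtain ⟨s, hs⟩ := j.pos
    have := List.foldl_positions j.pre 0
    simp only [List.range_zero] at this
    simp [this, hs]
  · have := List.foldl_positions (l i) 0
    simp only [List.range_zero] at this
    simp [this]

theorem re {z : ι → ℂ} : PolyTime M .car z (fun i => (z i).re) := op fun _ => rfl
theorem im {z : ι → ℂ} : PolyTime M .cdr z (fun i => (z i).im) := op fun _ => rfl

theorem complex {x y : ι → ℝ} {z : ι → ℂ} (hP : PolyTime M P u x) (hQ : PolyTime M Q u y)
    (hx : ∀ i, x i = (z i).re) (hy : ∀ i, y i = (z i).im) : PolyTime M (.fork P Q) u z := by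
  obtain rfl : x = fun i => (z i).re := funext hx
  obtain rfl : y = fun i => (z i).im := funext hy
  exact hP.fork hQ

theorem natCast_complex {x : ι → ℕ} (hP : PolyTime M P u x) :
    PolyTime M (.fork P (.quote (.num 0))) u (fun i => (x i : ℂ)) :=
  complex (x := fun i => (x i : ℝ)) hP (quote (0 : ℝ)) (by simp) (by simp)

theorem addComplex {z w : ι → ℂ} :
    PolyTime M .addComplex (fun i => (z i, w i)) (fun i => z i + w i) :=
  complex (app₂ add_real (car.seq re) (cdr.seq re)) (app₂ add_real (car.seq im) (cdr.seq im))
    (by simp) (by simp)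

theorem mulComplex {z w : ι → ℂ} :
    PolyTime M .mulComplex (fun i => (z i, w i)) (fun i => z i * w i) :=
  complex
    (app₂ sub_real (app₂ mul_real (car.seq re) (cdr.seq re))
      (app₂ mul_real (car.seq im) (cdr.seq im)))
    (app₂ add_real (app₂ mul_real (car.seq re) (cdr.seq im))
      (app₂ mul_real (car.seq im) (cdr.seq re))) (by simp) (by simp)

theorem sumComplex {l : ι → List ℂ} (hl : PolyBounded M fun i => (l i).length) :
    PolyTime M .sumComplex l (fun i => (l i).sum) :=
  (fold (fun _ z w => z + w) id (quote (0 : ℂ)) hl (app₂ addComplex var₁ var_zero)).congr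
    fun _ => (List.sum_eq_foldl ..).symm

end PolyTime

/-! ### The algorithm, as a function on lists -/

/-- The adjacency lists of the subgraph induced on the list `U` of vertices. -/
def inducedAdj (g : List (List ℕ)) (U : List ℕ) : List (List ℕ) :=
  (List.range U.length).map fun a => (List.range U.length).filter fun b =>
    decide (U.getD b 0 ∈ g.getD (U.getD a 0) [])

/-- One step in the enumeration of signed subsets: add `x` or change the sign. -/
def signedStep (r : List (ℂ × List ℕ)) (x : ℕ) : List (ℂ × List ℕ) :=
  r.flatMap fun q => [(q.1, x :: q.2), (-1 * q.1, q.2)]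

/-- The subsets `T` of `A`, with the sign of the parity of `A \ T`. -/
def signedSubsets (A : List ℕ) : List (ℂ × List ℕ) := A.foldl signedStep [(1, [])]

/-- The sum of `μ U i` over the subsets `U` of `T` with at most `α * i` elements. -/
def coeffSum (α : ℕ) (μ : List ℕ → ℕ → ℂ) (T : List ℕ) (i : ℕ) : ℂ :=
  ((signedSubsets T).map fun q => if decide (q.2.length ≤ α * i) then μ q.2 i else 0).sum

/-- Prepend the next power sum to the list `ps` of the previous ones, in decreasing order, for the
polynomial with the coefficients `es`, from that of degree `1` on. -/
def newtonStep (es ps : List ℂ) : List ℂ :=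
  (-1 * ((List.range (ps ++ [((ps.length + 1 : ℕ) : ℂ)]).length).map fun i =>
    es.getD i 0 * (ps ++ [((ps.length + 1 : ℕ) : ℂ)]).getD i 0).sum) :: ps

/-- The inverse power sums of the polynomial `1 + es[0] z + es[1] z² + ⋯`, in decreasing order. -/
def newton (es : List ℂ) : List ℂ := es.foldl (fun ps _ => newtonStep es ps) []

/-- The last inverse power sum of the polynomial with coefficients `coeffSum`; the list `js`
holds the numbers below its index. -/
def lastPowerSum (α : ℕ) (μ : List ℕ → ℕ → ℂ) (T js : List ℕ) : ℂ :=
  (newton (js.map fun j => coeffSum α μ T (j + 1))).getD 0 0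

/-- A state of the search for connected sets: the vertices that have been chosen, those that have
been excluded, and those that are still to be considered. -/
abbrev SearchState : Type := List ℕ × List ℕ × List ℕ

/-- Choose or exclude the first vertex to be considered, if there is any. -/
def searchStep (g : List (List ℕ)) (s : ℕ) (q : SearchState) : List SearchState :=
  if !q.2.2.isEmpty then
    if decide (q.2.2.headD 0 ∈ q.1) then [(q.1, q.2.1, q.2.2.tail)]
    else if decide (q.2.2.headD 0 ∈ q.2.1) then [(q.1, q.2.1, q.2.2.tail)]
    else if decide (q.1.length + 1 ≤ s) then
      [(q.2.2.headD 0 :: q.1, q.2.1, g.getD (q.2.2.headD 0) [] ++ q.2.2.tail),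
        (q.1, q.2.2.headD 0 :: q.2.1, q.2.2.tail)]
    else [(q.1, q.2.2.headD 0 :: q.2.1, q.2.2.tail)]
  else [q]

/-- The initial states: a vertex is chosen, and all greater vertices are excluded. -/
def searchInit (g : List (List ℕ)) : List SearchState :=
  (List.range g.length).map fun v =>
    ([v], (List.range g.length).filter (fun w => !decide (w ≤ v)), g.getD v [])

/-- The states after `rs.length` rounds. -/
def search (g : List (List ℕ)) (s : ℕ) (rs : List ℕ) : List SearchState :=
  rs.foldl (fun qs _ => qs.flatMap (searchStep g s)) (searchInit g)

/-- The alternating sum of the `j + 1`-st inverse power sums of the subgraphs of `A`. -/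
def connectedTerm (α : ℕ) (μ : List ℕ → ℕ → ℂ) (A : List ℕ) (m j : ℕ) : ℂ :=
  ((signedSubsets A).map fun q =>
    q.1 * lastPowerSum α μ q.2 ((List.range m).filter fun k => decide (k ≤ j))).sum

/-! ### The algorithm, as a program -/

namespace Prog

/-- The entry number `K` of the list `L`, or else `D`. -/
def lookup (D K L : Prog) : Prog := .seq (.fork D (.fork K L)) getD

/-- `inducedAdj g U` on input `(g, U)`. -/
def inducedAdj : Prog :=
  map (.seq cdr positions) <| filter (.seq (env 2) positions) <|
    app₂ mem (lookup (quote (.num 0)) (var 0) (env 3))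
      (lookup (quote .nil) (lookup (quote (.num 0)) (var 1) (env 3)) (var 2))

def signedSubsets : Prog :=
  fold (.op .id) (quote (enc [((1 : ℂ), ([] : List ℕ))])) <| flatMap (var 1) <|
    .fork (.fork (.seq (var 0) car) (.fork (var 1) (.seq (var 0) cdr)))
      (.fork (.fork (app₂ mulComplex (quote (enc (-1 : ℂ))) (.seq (var 0) car)) (.seq (var 0) cdr))
        (quote .nil))

/-- `coeffSum α μ T i` on input `(T, i, g)`, where `A` computes `μ`. -/
def coeffSum (α : ℕ) (A : Prog) : Prog :=
  .seq (map (.seq (var 0) signedSubsets) <|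
    .ite (app₂ (.op .le) (.seq (.seq (var 0) cdr) length) (app₂ (.op .mul) (quote (enc α)) (var 2)))
      (app₂ A (app₂ inducedAdj (env 3) (.seq (var 0) cdr)) (var 2))
      (quote (enc (0 : ℂ)))) sumComplex

/-- `newtonStep es ps` on input `(ps, es)`. -/
def newtonStep : Prog :=
  bind (app₂ append (var 0) (.fork (.fork (app₂ (.op .add) (.seq (var 0) length) (quote (.num 1)))
      (quote (.num 0))) (quote .nil))) <|
    .fork (app₂ mulComplex (quote (enc (-1 : ℂ))) <| .seq (map (.seq (var 0) positions) <|
      app₂ mulComplex (lookup (quote (enc (0 : ℂ))) (var 0) (env 3))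
        (lookup (quote (enc (0 : ℂ))) (var 0) (var 1))) sumComplex) (var 1)

def newton : Prog := fold (.op .id) (quote .nil) (.seq cdr newtonStep)

/-- `lastPowerSum α μ T js` on input `(T, js, g)`, where `A` computes `μ`. -/
def lastPowerSum (α : ℕ) (A : Prog) : Prog :=
  lookup (quote (enc (0 : ℂ))) (quote (.num 0)) <| .seq (map (var 1) <|
    .seq (.fork (var 1) (.fork (app₂ (.op .add) (var 0) (quote (.num 1))) (env 3)))
      (coeffSum α A)) newton

/-- `searchStep g s q` on input `(q, g, s)`. -/
def searchStep : Prog :=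
  .ite (.seq (.seq (.seq car cdr) cdr) (.op .consp))
    (bind (.seq (.seq (.seq car cdr) cdr) cdr) <| bind (.seq (.seq (.seq (var 1) cdr) cdr) car) <|
      .ite (app₂ mem (var 0) (.seq (var 2) car))
        (.fork (.fork (.seq (var 2) car) (.fork (.seq (.seq (var 2) cdr) car) (var 1)))
          (quote .nil)) <|
      .ite (app₂ mem (var 0) (.seq (.seq (var 2) cdr) car))
        (.fork (.fork (.seq (var 2) car) (.fork (.seq (.seq (var 2) cdr) car) (var 1)))
          (quote .nil)) <|
      .ite (app₂ (.op .le) (app₂ (.op .add) (.seq (.seq (var 2) car) length) (quote (.num 1)))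
          (env 4))
        (.fork (.fork (.fork (var 0) (.seq (var 2) car)) (.fork (.seq (.seq (var 2) cdr) car)
            (app₂ append (lookup (quote .nil) (var 0) (var 3)) (var 1))))
          (.fork (.fork (.seq (var 2) car) (.fork (.fork (var 0) (.seq (.seq (var 2) cdr) car))
            (var 1))) (quote .nil)))
        (.fork (.fork (.seq (var 2) car) (.fork (.fork (var 0) (.seq (.seq (var 2) cdr) car))
            (var 1))) (quote .nil)))
    (.fork car (quote .nil))

def searchInit : Prog :=
  map positions <| .fork (.fork (var 0) (quote .nil)) <|
    .fork (filter (.seq (env 1) positions) (not (app₂ (.op .le) (var 0) (var 1))))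
      (lookup (quote .nil) (var 0) (env 1))

/-- `search g s rs` on input `(rs, g, s)`. -/
def search : Prog :=
  fold car (.seq (var 1) searchInit) <| flatMap (var 1) <| .seq (.fork (var 0) (env 4)) searchStep

/-- `connectedTerm α μ A m j` on input `(A, j, g, range m)`, where `A` computes `μ`. -/
def connectedTerm (α : ℕ) (A : Prog) : Prog :=
  .seq (map (.seq car signedSubsets) <| app₂ mulComplex (.seq (var 0) car) <|
    .seq (.fork (.seq (var 0) cdr) (.fork
      (filter (env 4) (app₂ (.op .le) (var 0) (var 3))) (var 3)))
      (lastPowerSum α A)) sumComplex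

end Prog

/-! ### Running times -/

theorem List.length_getD_le {X : Type} {l : List (List X)} {b : ℕ} (h : ∀ r ∈ l, r.length ≤ b)
    (k : ℕ) : (l.getD k []).length ≤ b := by
  rw [List.getD_eq_getElem?_getD]
  cases hk : l[k]? with
  | none => simp
  | some r => exact h r (List.mem_of_getElem? hk)

theorem length_signedStep (r : List (ℂ × List ℕ)) (x : ℕ) :
    (signedStep r x).length = 2 * r.length := by
  simp [signedStep, List.length_flatMap, mul_comm]

theorem length_foldl_signedStep (A : List ℕ) (r : List (ℂ × List ℕ)) :
    (A.foldl signedStep r).length = 2 ^ A.length * r.length := by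
  induction A generalizing r with
  | nil => simp
  | cons x A ih => rw [List.foldl_cons, ih, length_signedStep, List.length_cons, pow_succ]; ring

theorem length_signedSubsets (A : List ℕ) : (signedSubsets A).length = 2 ^ A.length := by
  simp [signedSubsets, length_foldl_signedStep]

/-- Elements are chosen in order but prepended, so reversal appears. Being a sublist yields both the
length bound and the absence of repetitions. -/
theorem sublist_of_mem_foldl_signedStep (A B : List ℕ) (r : List (ℂ × List ℕ))
    (hr : ∀ q ∈ r, q.2.Sublist B) :
    ∀ q ∈ A.foldl signedStep r, q.2.Sublist (A.reverse ++ B) := by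
  induction A generalizing r B with
  | nil => simpa using hr
  | cons x A ih =>
    intro q hq
    rw [List.foldl_cons] at hq
    have := ih (x :: B) (signedStep r x) ?_ q hq
    · simpa using this
    · intro q hq
      simp only [signedStep, List.mem_flatMap] at hq
      obtain ⟨q', hq', h⟩ := hq
      have := hr q' hq'
      simp only [List.mem_cons, List.not_mem_nil, or_false] at h
      rcases h with rfl | rfl
      · exact this.cons_cons x
      · exact this.cons x

theorem sublist_of_mem_signedSubsets {A : List ℕ} {q : ℂ × List ℕ} (hq : q ∈ signedSubsets A) :
    q.2.Sublist A.reverse := by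
  simpa using sublist_of_mem_foldl_signedStep A [] [(1, [])] (by simp) q hq

theorem length_le_of_mem_signedSubsets {A : List ℕ} {q : ℂ × List ℕ} (hq : q ∈ signedSubsets A) :
    q.2.length ≤ A.length := by
  simpa using (sublist_of_mem_signedSubsets hq).length_le

theorem nodup_of_mem_signedSubsets {A : List ℕ} (hA : A.Nodup) {q : ℂ × List ℕ}
    (hq : q ∈ signedSubsets A) : q.2.Nodup :=
  (sublist_of_mem_signedSubsets hq).nodup (List.nodup_reverse.2 hA)

theorem length_newton_foldl (es l ps : List ℂ) :
    (l.foldl (fun ps _ => newtonStep es ps) ps).length = ps.length + l.length := by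
  induction l generalizing ps with
  | nil => simp
  | cons x l ih => rw [List.foldl_cons, ih]; simp [newtonStep]; omega

theorem length_newton (es : List ℂ) : (newton es).length = es.length := by
  simp [newton, length_newton_foldl]

/-- The program `A` computes `μ i U k` from the subgraph of `g i` induced on `U` and `k`, for lists
`U` with at most `α * k` and at most `s i` entries, in time polynomial in `M i`. -/
def Callable {ι : Type} (M : ι → ℕ) (A : Prog) (α : ℕ) (g : ι → List (List ℕ)) (s : ι → ℕ)
    (μ : ι → List ℕ → ℕ → ℂ) : Prop :=
  ∃ c : ℕ, ∀ (i : ι) (U : List ℕ) (k : ℕ), U.Nodup → U.length ≤ α * k → U.length ≤ s i →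
    ∃ t ≤ (M i + 2) ^ c, A.Run (enc (inducedAdj (g i) U, k)) (enc (μ i U k)) t

namespace Callable

variable {ι κ : Type} {M : ι → ℕ} {A : Prog} {α : ℕ} {g : ι → List (List ℕ)} {s : ι → ℕ}
    {μ : ι → List ℕ → ℕ → ℂ}

theorem comap (h : Callable M A α g s μ) (f : κ → ι) :
    Callable (fun k => M (f k)) A α (fun k => g (f k)) (fun k => s (f k)) (fun k => μ (f k)) :=
  h.imp fun _ hc k => hc (f k)

theorem polyTime (h : Callable M A α g s μ) {U : ι → List ℕ} {k : ι → ℕ} (hU : ∀ i, (U i).Nodup)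
    (hα : ∀ i, (U i).length ≤ α * k i) (hs : ∀ i, (U i).length ≤ s i) :
    PolyTime M A (fun i => (inducedAdj (g i) (U i), k i)) (fun i => μ i (U i) (k i)) := by
  obtain ⟨c, hc⟩ := h
  exact ⟨fun i => (M i + 2) ^ c, ⟨c, fun _ => le_rfl⟩, fun i => hc i _ _ (hU i) (hα i) (hs i)⟩

end Callable

namespace PolyTime

variable {ι Γ X : Type} [Enc Γ] [Enc X] {M : ι → ℕ} {P Q D K L : Prog} {u : ι → Γ}
  {g : ι → List (List ℕ)} {d : ι → ℕ}

theorem env₄ {X₀ X₁ X₂ X₃ : Type} [Enc X₀] [Enc X₁] [Enc X₂] [Enc X₃] {x₀ : ι → X₀}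
    {x₁ : ι → X₁} {x₂ : ι → X₂} {x₃ : ι → X₃} {v : ι → Γ} :
    PolyTime M (.env 4) (fun i => (x₀ i, x₁ i, x₂ i, x₃ i, v i)) v := env_succ env₃

theorem lookup {d : ι → X} {k : ι → ℕ} {l : ι → List X} (hD : PolyTime M D u d)
    (hK : PolyTime M K u k) (hL : PolyTime M L u l) (hl : PolyBounded M fun i => (l i).length) :
    PolyTime M (.lookup D K L) u (fun i => (l i).getD (k i) (d i)) :=
  (hD.fork (hK.fork hL)).seq (getD hl)

theorem inducedAdj (hg : PolyBounded M fun i => (g i).length) (hd : PolyBounded M d)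
    (hgd : ∀ i, ∀ r ∈ g i, r.length ≤ d i) {U : ι → List ℕ}
    (hU : PolyBounded M fun i => (U i).length) :
    PolyTime M .inducedAdj (fun i => (g i, U i)) (fun i => inducedAdj (g i) (U i)) := by
  have hU' : PolyBounded M fun i => (List.range (U i).length).length := by simpa using hU
  refine map (cdr.seq (positions hU)) hU' ?_
  refine filter (env₂.seq (positions (hU.comap MemIdx.i))) (hU'.comap MemIdx.i) ?_
  refine app₂ (mem ?_) (lookup quote_zero var_zero env₃ ?_)
    (lookup nil (lookup quote_zero var₁ env₃ ?_) var₂ ?_)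
  · exact ((hd.comap MemIdx.i).comap MemIdx.i).mono fun j => List.length_getD_le (hgd _) _
  · exact (hU.comap MemIdx.i).comap MemIdx.i
  · exact (hU.comap MemIdx.i).comap MemIdx.i
  · exact (hg.comap MemIdx.i).comap MemIdx.i

theorem signedSubsets {A : ι → List ℕ} (hA : PolyBounded M fun i => 2 ^ (A i).length) :
    PolyTime M .signedSubsets A (fun i => signedSubsets (A i)) := by
  refine fold (fun _ => signedStep) id (quote [((1 : ℂ), ([] : List ℕ))])
    (hA.mono fun i => Nat.lt_two_pow_self.le) (flatMap var₁ ?_ (.const 2) ?_)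
  · refine (hA.comap PosIdx.i).mono fun j => ?_
    obtain ⟨s, hs⟩ := j.pos
    rw [length_foldl_signedStep, hs]
    simpa using Nat.pow_le_pow_right (by omega) (by omega)
  · exact cons (fork (car.seq car) (cons var₁ (car.seq cdr)))
      (cons (fork (app₂ mulComplex (quote (-1 : ℂ)) (car.seq car)) (car.seq cdr)) nil)

end PolyTime

/-! ### Size and termination of the search -/

theorem searchStep_of_eq_nil (g : List (List ℕ)) (s : ℕ) (A X : List ℕ) :
    searchStep g s (A, X, []) = [(A, X, [])] := rfl

theorem searchStep_cons (g : List (List ℕ)) (s : ℕ) (A X F : List ℕ) (w : ℕ) :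
    searchStep g s (A, X, w :: F) =
      if w ∈ A ∨ w ∈ X then [(A, X, F)]
      else if A.length + 1 ≤ s then [(w :: A, X, g.getD w [] ++ F), (A, w :: X, F)]
      else [(A, w :: X, F)] := by
  by_cases h₁ : w ∈ A
  · simp [searchStep, h₁]
  · by_cases h₂ : w ∈ X <;> simp [searchStep, h₁, h₂]

theorem length_searchStep_le (g : List (List ℕ)) (s : ℕ) (q : SearchState) :
    (searchStep g s q).length ≤ 2 := by
  unfold searchStep
  split_ifs <;> simp

theorem search_concat (g : List (List ℕ)) (s : ℕ) (rs : List ℕ) (r : ℕ) :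
    search g s (rs ++ [r]) = (search g s rs).flatMap (searchStep g s) := by
  simp [search]

theorem length_search_le (g : List (List ℕ)) (s : ℕ) (rs : List ℕ) :
    (search g s rs).length ≤ 2 ^ rs.length * g.length := by
  induction rs using List.reverseRecOn with
  | nil => simp [search, searchInit]
  | append_singleton rs r ih =>
    rw [search_concat, List.length_flatMap]
    have : (List.map (fun q => (searchStep g s q).length) (search g s rs)).sum ≤
        (search g s rs).length * 2 := by
      have := List.sum_le_card_nsmul (List.map (fun q => (searchStep g s q).length)
        (search g s rs)) 2 (by
          intro x hx
          obtain ⟨q, -, rfl⟩ := List.mem_map.1 hx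
          exact length_searchStep_le g s q)
      simpa using this
    rw [List.length_append, List.length_singleton, pow_succ]
    nlinarith

/-- The size of the states: the number of chosen vertices stays below `s`, and every round uses
up one of the vertices that can ever be considered. -/
theorem searchStep_bound {g : List (List ℕ)} {s d : ℕ} (hg : ∀ r ∈ g, r.length ≤ d)
    {q q' : SearchState} (hq : q.1.length ≤ s) (h : q' ∈ searchStep g s q) :
    q'.1.length ≤ s ∧ q'.2.1.length ≤ q.2.1.length + 1 ∧
      (q'.2.2 = [] ∨
        q'.2.2.length + d * (s - q'.1.length) + 1 ≤ q.2.2.length + d * (s - q.1.length)) := by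
  obtain ⟨A, X, F⟩ := q
  dsimp only at hq
  cases F with
  | nil =>
    rw [searchStep_of_eq_nil, List.mem_singleton] at h
    subst h
    exact ⟨hq, Nat.le_succ _, Or.inl rfl⟩
  | cons w F =>
    rw [searchStep_cons] at h
    split_ifs at h with h₁ h₂
    · rw [List.mem_singleton] at h
      subst h
      refine ⟨hq, Nat.le_succ _, Or.inr ?_⟩
      simp only [List.length_cons]
      omega
    · rw [List.mem_pair] at h
      rcases h with rfl | rfl
      · refine ⟨h₂, Nat.le_succ _, Or.inr ?_⟩
        -- Choosing `w` brings in at most `d` new vertices, paid for by the drop of `d * (s -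
        -- A.length)` by `d`; the removal of `w` itself gives the net decrease.
        have := List.length_getD_le hg w
        obtain ⟨e, rfl⟩ := Nat.exists_eq_add_of_le h₂
        have h3 : A.length + 1 + e - A.length = e + 1 := by omega
        have h4 : A.length + 1 + e - (A.length + 1) = e := by omega
        simp only [List.length_cons, List.length_append, h3, h4, mul_add, mul_one]
        omega
      · refine ⟨hq, le_rfl, Or.inr ?_⟩
        simp only [List.length_cons]
        omega
    · rw [List.mem_singleton] at h
      subst h
      refine ⟨hq, le_rfl, Or.inr ?_⟩
      simp only [List.length_cons]
      omega

/-- The potential is the number of waiting vertices plus `d` for each vertex that may still be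
chosen. It starts at no more than `d * s`, as the initial vertex has used up one choice, and each
round lowers it by at least one until nothing waits. -/
theorem search_bound {g : List (List ℕ)} {s d : ℕ} (hg : ∀ r ∈ g, r.length ≤ d) (hs : 1 ≤ s)
    (rs : List ℕ) : ∀ q ∈ search g s rs,
    q.1.length ≤ s ∧ q.2.1.length ≤ g.length + rs.length ∧
      (q.2.2 = [] ∨ q.2.2.length + d * (s - q.1.length) + rs.length ≤ d * s) := by
  induction rs using List.reverseRecOn with
  | nil =>
    intro q hq
    simp only [search, searchInit, List.foldl_nil, List.mem_map] at hq
    obtain ⟨v, -, rfl⟩ := hq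
    refine ⟨hs, ?_, Or.inr ?_⟩
    · simpa using List.length_filter_le (fun w => !decide (w ≤ v)) (List.range g.length)
    · have := List.length_getD_le hg v
      obtain ⟨e, rfl⟩ := Nat.exists_eq_add_of_le hs
      have h3 : 1 + e - [v].length = e := by simp
      simp only [h3, mul_add, mul_one, List.length_nil]
      omega
  | append_singleton rs r ih =>
    intro q' hq'
    rw [search_concat, List.mem_flatMap] at hq'
    obtain ⟨q, hq, h⟩ := hq'
    obtain ⟨h1, h2, h3⟩ := ih q hq
    obtain ⟨h4, h5, h6⟩ := searchStep_bound hg h1 h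
    refine ⟨h4, by simp only [List.length_append, List.length_singleton]; omega, ?_⟩
    simp only [List.length_append, List.length_singleton]
    rcases h6 with h6 | h6
    · exact Or.inl h6
    · rcases h3 with h3 | h3
      · obtain ⟨A, X, F⟩ := q
        dsimp only at h3
        subst h3
        rw [searchStep_of_eq_nil, List.mem_singleton] at h
        subst h
        exact Or.inl rfl
      · right; omega

/-- States that finish early are fixed by `searchStep`, so one number of rounds serves for all of
them. -/
theorem search_done {g : List (List ℕ)} {s d : ℕ} (hg : ∀ r ∈ g, r.length ≤ d) (hs : 1 ≤ s)
    {rs : List ℕ} (hrs : d * s ≤ rs.length) : ∀ q ∈ search g s rs, q.2.2 = [] := by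
  intro q hq
  rcases (search_bound hg hs rs q hq).2.2 with h | h
  · exact h
  · exact List.length_eq_zero_iff.1 (by omega)

/-! ### Running times of the composite programs -/

namespace PolyTime

variable {ι Γ X : Type} [Enc Γ] [Enc X] {M : ι → ℕ} {P Q D K L : Prog} {u : ι → Γ}
  {g : ι → List (List ℕ)} {d s : ι → ℕ} {α : ℕ} {A : Prog} {μ : ι → List ℕ → ℕ → ℂ}

theorem coeffSum (hg : PolyBounded M fun i => (g i).length) (hd : PolyBounded M d)
    (hgd : ∀ i, ∀ r ∈ g i, r.length ≤ d i) (hs : PolyBounded M fun i => 2 ^ s i)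
    (hA : Callable M A α g s μ) {T : ι → List ℕ} {k : ι → ℕ} (hT : ∀ i, (T i).Nodup)
    (hTs : ∀ i, (T i).length ≤ s i) :
    PolyTime M (.coeffSum α A) (fun i => (T i, k i, g i))
      (fun i => coeffSum α (μ i) (T i) (k i)) := by
  have h2 : PolyBounded M fun i => 2 ^ (T i).length :=
    hs.mono fun i => Nat.pow_le_pow_right (by omega) (hTs i)
  have h1 : PolyBounded M fun i => (T i).length := h2.mono fun i => Nat.lt_two_pow_self.le
  have h3 : PolyBounded M fun i => (_root_.signedSubsets (T i)).length := by
    simpa only [length_signedSubsets] using h2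
  have h4 : PolyBounded (fun j : MemIdx fun i => _root_.signedSubsets (T i) => M j.i)
      fun j => j.x.2.length :=
    (h1.comap MemIdx.i).mono fun j => length_le_of_mem_signedSubsets j.mem
  refine seq (map (f := fun i q => if decide (q.2.length ≤ α * k i) then μ i q.2 (k i) else 0)
    (car.seq (signedSubsets h2)) h3 ?_) (sumComplex (by simpa using h3))
  -- `A` is only known to halt on graphs with at most `α * k` vertices, so the rule with restricted
  -- branches is needed here instead of `cond`.
  refine ite (app₂ le_nat ((car.seq cdr).seq (length h4)) (app₂ mul_nat (quote α) var₂)) ?_ ?_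
  · refine congr (app₂ (((hA.comap MemIdx.i).comap Subtype.val).polyTime
      (U := fun j => j.1.x.2) (k := fun j => k j.1.i) ?_ ?_ ?_)
      (app₂ (inducedAdj (U := fun j : {j : MemIdx fun i => _root_.signedSubsets (T i) //
          decide (j.x.2.length ≤ α * k j.i) = true} => j.1.x.2)
        ((hg.comap MemIdx.i).comap Subtype.val)
        ((hd.comap MemIdx.i).comap Subtype.val) (fun j => hgd j.1.i) (h4.comap Subtype.val))
        env₃ (car.seq cdr)) var₂) ?_
    · exact fun j => nodup_of_mem_signedSubsets (hT _) j.1.mem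
    · exact fun j => by simpa using j.2
    · exact fun j => (length_le_of_mem_signedSubsets j.1.mem).trans (hTs _)
    · exact fun j => by rw [if_pos j.2]
  · refine (quote (0 : ℂ)).congr fun j => ?_
    have := j.2
    rw [if_neg (by simp [this])]

theorem newtonStep {es ps : ι → List ℂ} (he : PolyBounded M fun i => (es i).length)
    (hp : PolyBounded M fun i => (ps i).length) :
    PolyTime M .newtonStep (fun i => (ps i, es i)) (fun i => newtonStep (es i) (ps i)) := by
  have hc : PolyBounded M fun i => (ps i ++ [((((ps i).length + 1 : ℕ)) : ℂ)]).length := by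
    simpa using hp.add (.const 1)
  refine bind (x := fun i => ps i ++ [((((ps i).length + 1 : ℕ)) : ℂ)])
    (app₂ (append hp) var_zero
      (cons (natCast_complex (app₂ add_nat (car.seq (length hp)) quote_one)) nil)) ?_
  refine cons (app₂ mulComplex (quote (-1 : ℂ)) (seq (map (car.seq (positions hc))
    (by simpa using hc) ?_) (sumComplex (by simpa using hc)))) var₁
  exact app₂ mulComplex (lookup (quote (0 : ℂ)) var_zero env₃ (he.comap MemIdx.i))
    (lookup (quote (0 : ℂ)) var_zero var₁ (hc.comap MemIdx.i))

theorem newton {es : ι → List ℂ} (he : PolyBounded M fun i => (es i).length) :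
    PolyTime M .newton es (fun i => newton (es i)) := by
  refine fold (fun i ps _ => _root_.newtonStep (es i) ps) id nil he
    (cdr.seq (newtonStep (he.comap PosIdx.i) ?_))
  refine (he.comap PosIdx.i).mono fun j => ?_
  obtain ⟨s, hs⟩ := j.pos
  rw [length_newton_foldl, hs]
  simp

theorem lastPowerSum (hg : PolyBounded M fun i => (g i).length) (hd : PolyBounded M d)
    (hgd : ∀ i, ∀ r ∈ g i, r.length ≤ d i) (hs : PolyBounded M fun i => 2 ^ s i)
    (hA : Callable M A α g s μ) {T js : ι → List ℕ} (hT : ∀ i, (T i).Nodup)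
    (hTs : ∀ i, (T i).length ≤ s i) (hj : PolyBounded M fun i => (js i).length) :
    PolyTime M (.lastPowerSum α A) (fun i => (T i, js i, g i))
      (fun i => lastPowerSum α (μ i) (T i) (js i)) := by
  refine lookup (quote (0 : ℂ)) quote_zero (seq (map
    (f := fun i j => _root_.coeffSum α (μ i) (T i) (j + 1)) var₁ hj ?_)
    (newton (by simpa using hj))) (by simpa [length_newton] using hj)
  exact seq (fork var₁ (fork (app₂ add_nat var_zero quote_one) env₃))
    (coeffSum (hg.comap MemIdx.i) (hd.comap MemIdx.i) (fun j => hgd j.i) (hs.comap MemIdx.i)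
      (hA.comap MemIdx.i) (fun j => hT j.i) (fun j => hTs j.i))

theorem searchStep (hg : PolyBounded M fun i => (g i).length) (hd : PolyBounded M d)
    (hgd : ∀ i, ∀ r ∈ g i, r.length ≤ d i) {q : ι → SearchState}
    (hA : PolyBounded M fun i => (q i).1.length) (hX : PolyBounded M fun i => (q i).2.1.length) :
    PolyTime M .searchStep (fun i => (q i, g i, s i)) (fun i => searchStep (g i) (s i) (q i)) := by
  have hF : PolyTime M (.seq (.seq .car .cdr) .cdr) (fun i => (q i, g i, s i))
    (fun i => (q i).2.2) := (car.seq cdr).seq cdr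
  -- Taking the head and tail of an empty list is a run-time error; the restricted branch supplies
  -- nonemptiness.
  refine ite (hF.seq consp) ?_ ?_
  · let N := {i // (!(q i).2.2.isEmpty) = true}
    have hne : ∀ i : N, (q i).2.2 = (q i).2.2.headD 0 :: (q i).2.2.tail := by
      rintro ⟨i, hi⟩
      dsimp only at hi ⊢
      cases h : (q i).2.2 with
      | nil => simp [h] at hi
      | cons a l => rfl
    have hg := hg.comap (Subtype.val : N → ι)
    have hA := hA.comap (Subtype.val : N → ι)
    have hX := hX.comap (Subtype.val : N → ι)
    refine bind ((hF.comap Subtype.val).seq (tail hne))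
      (bind (((var₁.seq cdr).seq cdr).seq (head hne)) ?_)
    refine congr (cond (app₂ (mem hA) var_zero (var₂.seq car))
      (cons (fork (var₂.seq car) (fork ((var₂.seq cdr).seq car) var₁)) nil)
      (cond (app₂ (mem hX) var_zero ((var₂.seq cdr).seq car))
        (cons (fork (var₂.seq car) (fork ((var₂.seq cdr).seq car) var₁)) nil)
        (cond (app₂ le_nat (app₂ add_nat ((var₂.seq car).seq (length hA)) quote_one) env₄)
          (cons (fork (cons var_zero (var₂.seq car)) (fork ((var₂.seq cdr).seq car)
              (app₂ (append ?_) (lookup nil var_zero var₃ hg) var₁)))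
            (cons (fork (var₂.seq car) (fork (cons var_zero ((var₂.seq cdr).seq car)) var₁)) nil))
          (cons (fork (var₂.seq car) (fork (cons var_zero ((var₂.seq cdr).seq car)) var₁)) nil))))
      fun i => ?_
    · exact (hd.comap Subtype.val).mono fun i => List.length_getD_le (hgd _) _
    · have := i.2
      simp only [_root_.searchStep, this, if_true]
  · refine congr (cons car nil) fun i => ?_
    have := i.2
    simp only [_root_.searchStep, this]
    simp

theorem searchInit (hg : PolyBounded M fun i => (g i).length) :
    PolyTime M .searchInit g (fun i => searchInit (g i)) := by
  have hg' : PolyBounded M fun i => (List.range (g i).length).length := by simpa using hg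
  refine map (positions hg) hg' (fork (cons var_zero nil)
    (fork (filter (env₁.seq (positions (hg.comap MemIdx.i))) (hg'.comap MemIdx.i) ?_)
      (lookup nil var_zero env₁ (hg.comap MemIdx.i))))
  exact not (app₂ le_nat var_zero var₁)

theorem search (hg : PolyBounded M fun i => (g i).length) (hd : PolyBounded M d)
    (hgd : ∀ i, ∀ r ∈ g i, r.length ≤ d i) (hs : ∀ i, 1 ≤ s i) (hsb : PolyBounded M s)
    {rs : ι → List ℕ} (hr : PolyBounded M fun i => 2 ^ (rs i).length) :
    PolyTime M .search (fun i => (rs i, g i, s i)) (fun i => search (g i) (s i) (rs i)) := by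
  have hr' : PolyBounded M fun i => (rs i).length := hr.mono fun i => Nat.lt_two_pow_self.le
  have hpre : ∀ j : PosIdx rs, j.pre.length ≤ (rs j.i).length := fun j => by
    obtain ⟨s, hs⟩ := j.pos
    simp [hs]
  -- The accumulator after a prefix of the rounds is itself a search, so the size bounds hold for
  -- every intermediate state.
  have hmem : ∀ j : MemIdx fun j : PosIdx rs => _root_.search (g j.i) (s j.i) j.pre,
      _ := fun j => search_bound (hgd j.i.i) (hs j.i.i) j.i.pre j.x j.mem
  refine fold (u := fun i => (rs i, g i, s i))
    (fun i qs _ => qs.flatMap (_root_.searchStep (g i) (s i))) car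
    (var₁.seq (searchInit hg)) hr' ?_
  refine flatMap var₁ ?_ ?_ ?_
  rotate_left 2
  · refine seq (fork var_zero env₄)
      (searchStep ((hg.comap PosIdx.i).comap MemIdx.i) ((hd.comap PosIdx.i).comap MemIdx.i)
        (fun j => hgd j.i.i) ?_ ?_)
    · exact ((hsb.comap PosIdx.i).comap MemIdx.i).mono fun j => (hmem j).1
    · exact (((hg.add hr').comap PosIdx.i).comap MemIdx.i).mono fun j =>
        (hmem j).2.1.trans (Nat.add_le_add_left (hpre j.i) _)
  · exact ((hr.mul hg).comap PosIdx.i).mono fun j => (length_search_le _ _ _).trans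
      (Nat.mul_le_mul_right _ (Nat.pow_le_pow_right (by omega) (hpre j)))
  · exact (PolyBounded.const 2).mono fun j => length_searchStep_le _ _ _

theorem connectedTerm (hg : PolyBounded M fun i => (g i).length) (hd : PolyBounded M d)
    (hgd : ∀ i, ∀ r ∈ g i, r.length ≤ d i) (hs : PolyBounded M fun i => 2 ^ s i)
    (hA : Callable M A α g s μ) {T : ι → List ℕ} {j m : ι → ℕ} (hT : ∀ i, (T i).Nodup)
    (hTs : ∀ i, (T i).length ≤ s i) (hm : PolyBounded M m) :
    PolyTime M (.connectedTerm α A) (fun i => (T i, j i, g i, List.range (m i)))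
      (fun i => connectedTerm α (μ i) (T i) (m i) (j i)) := by
  have h2 : PolyBounded M fun i => 2 ^ (T i).length :=
    hs.mono fun i => Nat.pow_le_pow_right (by omega) (hTs i)
  have h3 : PolyBounded M fun i => (_root_.signedSubsets (T i)).length := by
    simpa only [length_signedSubsets] using h2
  have hm' : PolyBounded M fun i => (List.range (m i)).length := by simpa using hm
  refine seq (map (car.seq (signedSubsets h2)) h3 (app₂ mulComplex (car.seq car)
    (seq (fork (car.seq cdr) (fork (filter env₄ (hm'.comap MemIdx.i)
      (app₂ le_nat var_zero var₃)) var₃))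
      (lastPowerSum (hg.comap MemIdx.i) (hd.comap MemIdx.i) (fun j => hgd j.i) (hs.comap MemIdx.i)
        (hA.comap MemIdx.i) (fun j => nodup_of_mem_signedSubsets (hT _) j.mem)
        (fun j => (length_le_of_mem_signedSubsets j.mem).trans (hTs _)) ?_))))
    (sumComplex (by simpa using h3))
  exact (hm'.comap MemIdx.i).mono fun j => List.length_filter_le _ _

end PolyTime

/-! ### Newton's identities for inverse power sums -/

/-- This is the logarithmic derivative of the product: the factor 1 - rX contributes -r/(1 - rX),
the generating function of the -r^{j+1}. Induction with the product rule avoids any division. -/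
theorem Multiset.derivative_prod_one_sub (s : Multiset ℂ) :
    PowerSeries.derivative ℂ
        (s.map fun r => (1 : PowerSeries ℂ) - PowerSeries.C r * PowerSeries.X).prod =
      -((s.map fun r => (1 : PowerSeries ℂ) - PowerSeries.C r * PowerSeries.X).prod *
        PowerSeries.mk fun j => (s.map fun r => r ^ (j + 1)).sum) := by
  induction s using Multiset.induction_on with
  | empty =>
    have : (PowerSeries.mk fun _ : ℕ => (0 : ℂ)) = 0 := by ext; simp
    simp [this]
  | cons r s ih =>
    have hmk : (PowerSeries.mk fun j => ((r ::ₘ s).map fun r => r ^ (j + 1)).sum) =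
        (PowerSeries.mk fun j => r ^ (j + 1)) +
          PowerSeries.mk fun j => (s.map fun r => r ^ (j + 1)).sum := by
      ext; simp
    have hgeo : ((1 : PowerSeries ℂ) - PowerSeries.C r * PowerSeries.X) *
        (PowerSeries.mk fun j => r ^ (j + 1)) = PowerSeries.C r := by
      ext k
      rw [sub_mul, one_mul, mul_assoc, map_sub, PowerSeries.coeff_C_mul, PowerSeries.coeff_C]
      cases k with
      | zero => simp
      | succ k => simp [PowerSeries.coeff_succ_X_mul, pow_succ]; ring
    have hd : PowerSeries.derivative ℂ ((1 : PowerSeries ℂ) - PowerSeries.C r * PowerSeries.X) =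
        -PowerSeries.C r := by
      simp [Derivation.leibniz]
    rw [hmk, Multiset.map_cons, Multiset.prod_cons, Derivation.leibniz, ih, hd]
    simp only [smul_eq_mul]
    linear_combination ((s.map fun r => (1 : PowerSeries ℂ) -
      PowerSeries.C r * PowerSeries.X).prod) * hgeo

/-- Constant term 1 excludes the root 0, so -ζ can be pulled out of each factor X - ζ; comparing
constant terms shows that these scalars cancel the leading coefficient. -/
theorem Polynomial.eq_prod_one_sub_inv_roots {q : ℂ[X]} (hq : q.coeff 0 = 1) :
    q = (q.roots.map fun ζ => 1 - C ζ⁻¹ * X).prod := by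
  have h0 : q ≠ 0 := by rintro rfl; simp at hq
  have hroot : ∀ ζ ∈ q.roots, ζ ≠ 0 := by
    rintro ζ hζ rfl
    have := (mem_roots h0).1 hζ
    rw [IsRoot.def, ← coeff_zero_eq_eval_zero, hq] at this
    exact one_ne_zero this
  have hsp := (IsAlgClosed.splits q).eq_prod_roots
  have hfac : (q.roots.map fun ζ => X - C ζ).prod =
      C (q.roots.map fun ζ => -ζ).prod * (q.roots.map fun ζ => 1 - C ζ⁻¹ * X).prod := by
    rw [map_multiset_prod, Multiset.map_map, ← Multiset.prod_map_mul]
    refine congrArg _ (Multiset.map_congr rfl fun ζ hζ => ?_)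
    have : C ζ * C ζ⁻¹ = (1 : ℂ[X]) := by
      rw [← C_mul, mul_inv_cancel₀ (hroot ζ hζ), C_1]
    simp only [Function.comp, C_neg]
    linear_combination (-X) * this
  have hc : ((q.roots.map fun ζ => 1 - C ζ⁻¹ * X).prod).coeff 0 = 1 := by
    rw [coeff_zero_multiset_prod, Multiset.map_map]
    simp
  rw [hfac, ← mul_assoc, ← C_mul] at hsp
  have h1 : q.leadingCoeff * (q.roots.map fun ζ => -ζ).prod = 1 := by
    have := congrArg (fun f => coeff f 0) hsp
    simpa only [hq, coeff_C_mul, hc, mul_one] using this.symm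
  rw [h1, C_1, one_mul] at hsp
  exact hsp

/-- Compare coefficients of X^k in the logarithmic derivative and isolate the term that belongs to
the constant coefficient 1. There is no restriction on `k` relative to the degree. The identity
drives both the algorithm and the degree bound. -/
theorem invPowerSum_succ {q : ℂ[X]} (hq : q.coeff 0 = 1) (k : ℕ) :
    invPowerSum q (k + 1) = -(∑ i ∈ Finset.range k, q.coeff (i + 1) * invPowerSum q (k - i) +
      q.coeff (k + 1) * (k + 1)) := by
  have h := Multiset.derivative_prod_one_sub (q.roots.map fun ζ => ζ⁻¹)
  have hcoe : ((q.roots.map fun ζ => ζ⁻¹).map fun r =>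
      (1 : PowerSeries ℂ) - PowerSeries.C r * PowerSeries.X).prod = (q : PowerSeries ℂ) := by
    conv_rhs => rw [Polynomial.eq_prod_one_sub_inv_roots hq]
    rw [← Polynomial.coeToPowerSeries.ringHom_apply, map_multiset_prod, Multiset.map_map,
      Multiset.map_map]
    refine congrArg _ (Multiset.map_congr rfl fun ζ _ => ?_)
    simp
  rw [hcoe] at h
  have h := congrArg (PowerSeries.coeff k) h
  rw [PowerSeries.coeff_derivative, map_neg, PowerSeries.coeff_mul,
    Finset.Nat.sum_antidiagonal_eq_sum_range_succ_mk, Finset.sum_range_succ'] at h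
  simp only [Polynomial.coeff_coe, PowerSeries.coeff_mk, Multiset.map_map, Function.comp_def,
    hq, one_mul, Nat.sub_zero] at h
  have hsum : ∀ i ∈ Finset.range k, q.coeff (i + 1) *
      (q.roots.map fun ζ => ζ⁻¹ ^ (k - (i + 1) + 1)).sum =
      q.coeff (i + 1) * invPowerSum q (k - i) := by
    intro i hi
    rw [Finset.mem_range] at hi
    rw [invPowerSum, show k - (i + 1) + 1 = k - i by omega]
  rw [Finset.sum_congr rfl hsum] at h
  rw [h]
  simp only [invPowerSum]
  ring

theorem invPowerSum_one (j : ℕ) : invPowerSum 1 j = 0 := by simp [invPowerSum]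

theorem invPowerSum_mul {q r : ℂ[X]} (h : q * r ≠ 0) (j : ℕ) :
    invPowerSum (q * r) j = invPowerSum q j + invPowerSum r j := by
  simp [invPowerSum, roots_mul h]

/-- The list `l` merely counts rounds. Since the power sums are stored in decreasing order, the
convolution in Newton's identity is an entrywise product of two lists. -/
theorem newton_foldl_eq {q : ℂ[X]} (hq : q.coeff 0 = 1) (k : ℕ) (l : List ℂ) (hl : l.length ≤ k) :
    l.foldl (fun ps _ => newtonStep ((List.range k).map fun j => q.coeff (j + 1)) ps) [] =
      (List.range l.length).map fun i => invPowerSum q (l.length - i) := by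
  induction l using List.reverseRecOn with
  | nil => rfl
  | append_singleton l x ih =>
    rw [List.length_append, List.length_singleton] at hl
    rw [List.foldl_append, List.foldl_cons, List.foldl_nil, ih (by omega), List.length_append,
      List.length_singleton, List.range_succ_eq_map, List.map_cons, newtonStep, Nat.sub_zero,
      List.map_map]
    congr 1
    · rw [invPowerSum_succ hq]
      simp only [List.length_map, List.length_range, List.length_append, List.length_singleton]
      rw [neg_one_mul]
      congr 1
      -- The number appended at the end of the power sums meets the top coefficient and yields the
      -- extra term of the identity.
      rw [List.range_succ, List.map_append, List.sum_append, ← List.sum_toFinset _ List.nodup_range]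
      congr 1
      · rw [List.toFinset_range]
        refine Finset.sum_congr rfl fun i hi => ?_
        rw [Finset.mem_range] at hi
        rw [List.getD_eq_getElem _ _ (by simp; omega), List.getD_eq_getElem _ _ (by simp; omega),
          List.getElem_append_left (by simpa using hi)]
        simp
      · rw [List.map_singleton, List.sum_singleton, List.getD_eq_getElem _ _ (by simp; omega),
          List.getD_eq_getElem _ _ (by simp)]
        simp
    · refine List.map_congr_left fun i _ => ?_
      simp

theorem newton_getD_zero {q : ℂ[X]} (hq : q.coeff 0 = 1) (k : ℕ) :
    (newton ((List.range (k + 1)).map fun j => q.coeff (j + 1))).getD 0 0 =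
      invPowerSum q (k + 1) := by
  rw [newton, newton_foldl_eq hq _ _ (by simp)]
  simp [List.range_succ_eq_map]

/-! ### Set functions of bounded degree -/

section Degree

variable {V : Type}

/-- The set function `f` is a combination of the indicators of `T ⊆ S` with `T.card ≤ d`. -/
def HasDegree (d : ℕ) (f : Finset V → ℂ) : Prop :=
  ∃ c : Finset V → ℂ, (∀ T, d < T.card → c T = 0) ∧ ∀ S, f S = ∑ T ∈ S.powerset, c T

namespace HasDegree

variable {d e : ℕ} {f g : Finset V → ℂ}

theorem congr (hf : HasDegree d f) (h : ∀ S, f S = g S) : HasDegree d g := by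
  rwa [← funext h]

theorem mono (hf : HasDegree d f) (h : d ≤ e) : HasDegree e f :=
  hf.imp fun _ hc => ⟨fun T hT => hc.1 T (by omega), hc.2⟩

theorem zero : HasDegree d fun _ : Finset V => (0 : ℂ) := ⟨fun _ => 0, by simp, by simp⟩

theorem add (hf : HasDegree d f) (hg : HasDegree d g) : HasDegree d fun S => f S + g S := by
  obtain ⟨a, ha, hf⟩ := hf
  obtain ⟨b, hb, hg⟩ := hg
  exact ⟨fun T => a T + b T, fun T hT => by simp [ha T hT, hb T hT],
    fun S => by simp only [hf, hg, Finset.sum_add_distrib]⟩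

theorem const_mul (z : ℂ) (hf : HasDegree d f) : HasDegree d fun S => z * f S := by
  obtain ⟨a, ha, hf⟩ := hf
  exact ⟨fun T => z * a T, fun T hT => by simp [ha T hT],
    fun S => by simp only [hf, Finset.mul_sum]⟩

theorem sum {n : ℕ} {F : ℕ → Finset V → ℂ} (hF : ∀ i < n, HasDegree d (F i)) :
    HasDegree d fun S => ∑ i ∈ Finset.range n, F i S := by
  induction n with
  | zero => simpa using zero
  | succ n ih =>
    simp only [Finset.sum_range_succ]
    exact (ih fun i hi => hF i (by omega)).add (hF n (by omega))

/-- The product of the indicators of T ⊆ S and T' ⊆ S is the indicator of T ∪ T' ⊆ S, and |T ∪ T'| ≤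
|T| + |T'|. Pairs are grouped by their union. -/
theorem mul [DecidableEq V] (hf : HasDegree d f) (hg : HasDegree e g) :
    HasDegree (d + e) fun S => f S * g S := by
  obtain ⟨a, ha, hf⟩ := hf
  obtain ⟨b, hb, hg⟩ := hg
  refine ⟨fun W => ∑ q ∈ W.powerset ×ˢ W.powerset with q.1 ∪ q.2 = W, a q.1 * b q.2, ?_, ?_⟩
  · intro W hW
    refine Finset.sum_eq_zero fun q hq => ?_
    rw [Finset.mem_filter] at hq
    have := Finset.card_union_le q.1 q.2
    rw [hq.2] at this
    by_cases h : d < q.1.card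
    · simp [ha _ h]
    · simp [hb q.2 (by omega)]
  · intro S
    dsimp only
    rw [hf, hg, Finset.sum_mul_sum, ← Finset.sum_product',
      ← Finset.sum_fiberwise_of_maps_to (t := S.powerset) (g := fun q => q.1 ∪ q.2)]
    · refine Finset.sum_congr rfl fun W hW => Finset.sum_congr ?_ fun _ _ => rfl
      rw [Finset.mem_powerset] at hW
      ext q
      simp only [Finset.mem_filter, Finset.mem_product, Finset.mem_powerset]
      constructor
      · rintro ⟨-, rfl⟩
        exact ⟨⟨Finset.subset_union_left, Finset.subset_union_right⟩, rfl⟩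
      · rintro ⟨⟨h1, h2⟩, h⟩
        exact ⟨⟨h1.trans hW, h2.trans hW⟩, h⟩
    · intro q hq
      simp only [Finset.mem_product, Finset.mem_powerset] at hq ⊢
      exact Finset.union_subset hq.1 hq.2

/-- Newton's identity is homogeneous when the i-th coefficient and the i-th power sum both have
weight i, so the degree bounds α times the weight propagate by induction. -/
theorem invPowerSum [DecidableEq V] {α : ℕ} {q : Finset V → ℂ[X]} (h0 : ∀ S, (q S).coeff 0 = 1)
    (hq : ∀ i, HasDegree (α * i) fun S => (q S).coeff i) (k : ℕ) :
    HasDegree (α * (k + 1)) fun S => invPowerSum (q S) (k + 1) := by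
  induction k using Nat.strong_induction_on with
  | _ k ih =>
    refine HasDegree.congr (f := fun S => (-1) * (∑ i ∈ Finset.range k,
      (q S).coeff (i + 1) * _root_.invPowerSum (q S) (k - i) +
      ((k + 1 : ℂ)) * (q S).coeff (k + 1))) ?_ fun S => ?_
    · refine const_mul _ (add (sum fun i hi => ?_) (const_mul _ (hq _)))
      have := ih (k - i - 1) (by omega)
      rw [show k - i - 1 + 1 = k - i by omega] at this
      refine ((hq (i + 1)).mul this).mono ?_
      rw [← mul_add]
      exact Nat.mul_le_mul_left _ (by omega)
    · rw [invPowerSum_succ (h0 S)]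
      ring

end HasDegree

end Degree

/-! ### Induced subgraphs -/

section Induced

variable {V : Type} (G : SimpleGraph V)

/-- The isomorphism class of the subgraph induced on a finite set of vertices. -/
def subClass (S : Finset V) : GraphClass := isoClass (G.induce (S : Set V))

theorem isoClass_comap {W : Type} [Fintype W] (φ : W ↪ V) :
    isoClass (G.comap φ) = subClass G (Finset.univ.map φ) := by
  refine (isoClass_eq_iff _ _).2 ⟨⟨(Equiv.ofInjective φ φ.injective).trans
    (Equiv.setCongr (by simp)), ?_⟩⟩
  intro a b
  rfl

theorem Finset.exists_map_univ_eq (S : Finset V) :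
    ∃ (n : ℕ) (φ : Fin n ↪ V), Finset.univ.map φ = S :=
  ⟨S.card, S.equivFin.symm.toEmbedding.trans (Function.Embedding.subtype _), by
    ext v
    simp only [Finset.mem_map, Finset.mem_univ, true_and, Function.Embedding.trans_apply,
      Equiv.coe_toEmbedding, Function.Embedding.subtype_apply]
    exact ⟨by rintro ⟨a, rfl⟩; exact (S.equivFin.symm a).2,
      fun hv => ⟨S.equivFin ⟨v, hv⟩, by simp⟩⟩⟩

theorem order_isoClass {W : Type} [Finite W] (F : SimpleGraph W) :
    (isoClass F).order = Nat.card W := rfl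

/-- Vertex sets are grouped by the isomorphism class they induce. This replaces induced subgraph
counts by a sum over sets, where Möbius inversion applies. -/
theorem sum_orderLE_ind {n d : ℕ} (F : SimpleGraph (Fin n)) (l : GraphClass → ℂ) :
    ∑ H ∈ GraphClass.orderLE d, l H * (ind H F : ℂ) =
      ∑ A : Finset (Fin n), if A.card ≤ d then l (subClass F A) else 0 := by
  classical
  have hind : ∀ H, ind H F =
      (Finset.univ.filter fun A : Finset (Fin n) => subClass F A = H).card := by
    intro H
    rw [ind, ← Set.ncard_coe_finset]
    refine (Set.ncard_congr (fun (A : Finset (Fin n)) _ => (A : Set (Fin n))) ?_ ?_ ?_).symm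
    · intro A hA
      exact (Finset.mem_filter.1 (Finset.mem_coe.1 hA)).2
    · intro A B _ _ h
      exact_mod_cast h
    · intro B hB
      obtain ⟨A, rfl⟩ : ∃ A : Finset (Fin n), (A : Set (Fin n)) = B := ⟨B.toFinset, by simp⟩
      exact ⟨A, Finset.mem_coe.2 (Finset.mem_filter.2 ⟨Finset.mem_univ _, hB⟩), rfl⟩
  rw [← Finset.sum_filter]
  rw [← Finset.sum_fiberwise_of_maps_to (t := GraphClass.orderLE d) (g := fun A => subClass F A)]
  · refine Finset.sum_congr rfl fun H hH => ?_
    rw [hind, Finset.filter_filter, Finset.sum_congr (s₂ := Finset.univ.filter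
      fun A : Finset (Fin n) => subClass F A = H) (g := fun _ => l H)]
    · rw [Finset.sum_const, nsmul_eq_mul, mul_comm]
    · ext A
      simp only [Finset.mem_filter, Finset.mem_univ, true_and, and_iff_right_iff_imp]
      rintro rfl
      simpa [GraphClass.orderLE, subClass, order_isoClass] using hH
    · intro A hA
      rw [(Finset.mem_filter.1 hA).2]
  · intro A hA
    simpa [GraphClass.orderLE, subClass, order_isoClass] using hA

/-- Induced subgraphs of G[S] are induced subgraphs of G, so one function of T serves all S at once.
This is the bounded degree of the coefficients as set functions. -/
theorem coeff_subClass {p : GraphClass → ℂ[X]} {α : ℕ} {lam : GraphClass → ℕ → ℂ}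
    (h : ∀ (n : ℕ) (G : SimpleGraph (Fin n)) (i : ℕ), (p (isoClass G)).coeff i =
      ∑ H ∈ GraphClass.orderLE (α * i), lam H i * (ind H G : ℂ)) (S : Finset V) (i : ℕ) :
    (p (subClass G S)).coeff i =
      ∑ T ∈ S.powerset, if T.card ≤ α * i then lam (subClass G T) i else 0 := by
  obtain ⟨n, φ, rfl⟩ := S.exists_map_univ_eq
  conv_lhs => rw [← isoClass_comap, h, sum_orderLE_ind _ fun H => lam H i]
  refine Finset.sum_bij (fun A _ => A.map φ) ?_ ?_ ?_ ?_
  · intro A _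
    rw [Finset.mem_powerset]
    exact Finset.map_subset_map.2 (Finset.subset_univ A)
  · intro A _ B _ h
    exact Finset.map_injective φ h
  · intro T hT
    rw [Finset.mem_powerset] at hT
    obtain ⟨A, -, rfl⟩ := Finset.subset_map_iff.1 hT
    exact ⟨A, Finset.mem_univ _, rfl⟩
  · intro A _
    rw [Finset.card_map]
    have : subClass (G.comap φ) A = subClass G (A.map φ) := by
      have h1 := isoClass_comap (G.comap φ) (Function.Embedding.subtype fun a => a ∈ A)
      have h2 := isoClass_comap G ((Function.Embedding.subtype fun a => a ∈ A).trans φ)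
      have h3 : (Finset.univ.map (Function.Embedding.subtype fun a => a ∈ A)) = A := by
        ext; simp
      rw [h3] at h1
      rw [← Finset.map_map, h3] at h2
      rw [← h1, ← h2]
      rfl
    rw [this]

theorem IsMultiplicative.subClass_union [DecidableEq V] {p : GraphClass → ℂ[X]}
    (hp : IsMultiplicative p)
    {A B : Finset V} (hAB : Disjoint A B) (hG : ∀ a ∈ A, ∀ b ∈ B, ¬G.Adj a b) :
    p (subClass G (A ∪ B)) = p (subClass G A) * p (subClass G B) := by
  obtain ⟨m, φ, rfl⟩ := A.exists_map_univ_eq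
  obtain ⟨n, ψ, rfl⟩ := B.exists_map_univ_eq
  have hφA : ∀ a, φ a ∈ Finset.univ.map φ := by simp
  have hψB : ∀ b, ψ b ∈ Finset.univ.map ψ := by simp
  let χ : Fin m ⊕ Fin n ↪ V := ⟨Sum.elim φ ψ, φ.injective.sumElim ψ.injective
    fun a b h => Finset.disjoint_left.1 hAB (hφA a) (h ▸ hψB b)⟩
  have hχ : Finset.univ.map χ = Finset.univ.map φ ∪ Finset.univ.map ψ := by
    ext v
    simp [χ]
  have hsum : SimpleGraph.sum (G.comap φ) (G.comap ψ) = G.comap χ := by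
    ext a b
    rcases a with a | a <;> rcases b with b | b
    · simp [χ]
    · simpa [χ] using hG _ (hφA a) _ (hψB b)
    · simpa [χ] using fun h : G.Adj _ _ => hG _ (hφA b) _ (hψB a) h.symm
    · simp [χ]
  have := hp.2 _ _ (G.comap φ) (G.comap ψ)
  rwa [hsum, isoClass_comap, isoClass_comap, isoClass_comap, hχ] at this

theorem IsMultiplicative.subClass_empty {p : GraphClass → ℂ[X]} (hp : IsMultiplicative p) :
    p (subClass G ∅) = 1 := by
  rw [← hp.1]
  congr 1
  have : IsEmpty ((∅ : Finset V) : Set V) := by simp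
  exact (isoClass_eq_iff _ _).2 ⟨⟨Equiv.equivOfIsEmpty _ _, fun {a} => isEmptyElim a⟩⟩

end Induced

/-! ### Alternating sums over subsets -/

section AltSum

variable {V : Type} [DecidableEq V]

/-- The iterated difference of a set function. -/
def altSum (f : Finset V → ℂ) : List V → Finset V → ℂ
  | [], B => f B
  | x :: l, B => altSum f l (insert x B) - altSum f l B

/-- The difference in the direction x cancels exactly the terms with x ∉ T. The expansion of `f` is
required only below `l.toFinset ∪ B`, so that expansions with only local validity can be compared.
-/
theorem altSum_eq_sum {f c : Finset V → ℂ} (l : List V) (B : Finset V) (hl : l.Nodup)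
    (hB : ∀ x ∈ l, x ∉ B) (h : ∀ S ⊆ l.toFinset ∪ B, f S = ∑ T ∈ S.powerset, c T) :
    altSum f l B = ∑ T ∈ (l.toFinset ∪ B).powerset with l.toFinset ⊆ T, c T := by
  induction l generalizing B with
  | nil => simpa [altSum] using h B (by simp)
  | cons x l ih =>
    rw [List.nodup_cons] at hl
    have hx : x ∉ l.toFinset ∪ B := by
      simpa [hl.1] using hB x (by simp)
    have hU : (x :: l).toFinset ∪ B = insert x (l.toFinset ∪ B) := by simp
    have hU' : l.toFinset ∪ insert x B = insert x (l.toFinset ∪ B) := by simp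
    rw [altSum, ih (insert x B) hl.2 ?_ (by rw [hU', ← hU]; exact h),
      ih B hl.2 (fun y hy => hB y (by simp [hy])) fun S hS => h S (hS.trans ?_), hU', hU]
    · rw [sub_eq_iff_eq_add, ← Finset.sum_filter_add_sum_filter_not _ (fun T => x ∈ T)]
      congr 1
      · refine Finset.sum_congr ?_ fun _ _ => rfl
        ext T
        simp only [Finset.mem_filter, List.toFinset_cons, Finset.insert_subset_iff]
        tauto
      · refine Finset.sum_congr ?_ fun _ _ => rfl
        ext T
        simp only [Finset.mem_filter, Finset.mem_powerset]
        constructor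
        · rintro ⟨⟨h1, h2⟩, h3⟩
          exact ⟨(Finset.subset_insert_iff_of_notMem h3).1 h1, h2⟩
        · rintro ⟨h1, h2⟩
          exact ⟨⟨h1.trans (Finset.subset_insert _ _), h2⟩, fun h3 => hx (h1 h3)⟩
    · rw [hU]
      exact Finset.subset_insert _ _
    · intro y hy hyB
      rcases Finset.mem_insert.1 hyB with rfl | hyB
      · exact hl.1 hy
      · exact hB y (by simp [hy]) hyB

theorem altSum_empty {f c : Finset V → ℂ} {l : List V} (hl : l.Nodup)
    (h : ∀ S ⊆ l.toFinset, f S = ∑ T ∈ S.powerset, c T) : altSum f l ∅ = c l.toFinset := by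
  rw [altSum_eq_sum l ∅ hl (by simp) (by simpa using h), Finset.union_empty]
  rw [Finset.sum_eq_single l.toFinset]
  · intro T hT hne
    simp only [Finset.mem_filter, Finset.mem_powerset] at hT
    exact absurd (hT.1.antisymm hT.2) hne
  · intro h
    simp at h

/-- The combinatorial differences of a set function that is additive on `A ∪ B` vanish there. -/
theorem coeff_eq_zero_of_additive {f c : Finset V → ℂ}
    (h : ∀ S, f S = ∑ T ∈ S.powerset, c T) {A B : Finset V} (hA : ¬A ⊆ B) (hB : ¬B ⊆ A)
    (hadd : ∀ S ⊆ A ∪ B, f S = f (S ∩ A) + f (S ∩ B)) : c (A ∪ B) = 0 := by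
  have h1 : altSum f (A ∪ B).toList ∅ = c (A ∪ B) := by
    have := altSum_empty (A ∪ B).nodup_toList (f := f) (c := c) fun S _ => h S
    rwa [Finset.toList_toFinset] at this
  -- Additivity provides a second expansion of `f` below `A ∪ B`, supported on subsets of `A` or of
  -- `B`. Both expansions have the same top coefficient, and here it is zero, as `A ∪ B` lies in
  -- neither set.
  have h2 : altSum f (A ∪ B).toList ∅ =
      (fun T => (if T ⊆ A then c T else 0) + if T ⊆ B then c T else 0) (A ∪ B) := by
    have := altSum_empty (A ∪ B).nodup_toList (f := f)
      (c := fun T => (if T ⊆ A then c T else 0) + if T ⊆ B then c T else 0) fun S hS => ?_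
    · rwa [Finset.toList_toFinset] at this
    rw [Finset.toList_toFinset] at hS
    have aux : ∀ C : Finset V, (∑ T ∈ S.powerset, if T ⊆ C then c T else 0) = f (S ∩ C) := by
      intro C
      rw [← Finset.sum_filter, h]
      refine Finset.sum_congr ?_ fun _ _ => rfl
      ext T
      simp only [Finset.mem_filter, Finset.mem_powerset, Finset.subset_inter_iff]
    rw [hadd S hS, Finset.sum_add_distrib, aux, aux]
  rw [← h1, h2]
  simp only [Finset.union_subset_iff, hA, hB, and_false, false_and, if_false, add_zero]

end AltSum

/-- One signed step replaces a set by itself with x added, minus itself, which is the recursion of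
`altSum`. The starting list is arbitrary to let the induction run. -/
theorem sum_foldl_signedStep (f : Finset ℕ → ℂ) (A : List ℕ) (r : List (ℂ × List ℕ)) :
    ((A.foldl signedStep r).map fun q => q.1 * f q.2.toFinset).sum =
      (r.map fun q => q.1 * altSum f A q.2.toFinset).sum := by
  induction A generalizing r with
  | nil => rfl
  | cons x A ih =>
    rw [List.foldl_cons, ih]
    induction r with
    | nil => rfl
    | cons q r ihr =>
      have : signedStep (q :: r) x = [(q.1, x :: q.2), (-1 * q.1, q.2)] ++ signedStep r x := rfl
      rw [this, List.map_append, List.sum_append, ihr]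
      simp [altSum]
      ring

theorem sum_signedSubsets_mul (f : Finset ℕ → ℂ) (A : List ℕ) :
    ((signedSubsets A).map fun q => q.1 * f q.2.toFinset).sum = altSum f A ∅ := by
  rw [signedSubsets, sum_foldl_signedStep]
  simp

theorem sum_foldl_signedStep_powerset (f : Finset ℕ → ℂ) (A : List ℕ) (hA : A.Nodup)
    (r : List (ℂ × List ℕ)) :
    ((A.foldl signedStep r).map fun q => f q.2.toFinset).sum =
      (r.map fun q => ∑ U ∈ A.toFinset.powerset, f (q.2.toFinset ∪ U)).sum := by
  induction A generalizing r with
  | nil => simp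
  | cons x A ih =>
    rw [List.nodup_cons] at hA
    rw [List.foldl_cons, ih hA.2]
    induction r with
    | nil => rfl
    | cons q r ihr =>
      have : signedStep (q :: r) x = [(q.1, x :: q.2), (-1 * q.1, q.2)] ++ signedStep r x := rfl
      have hx : x ∉ A.toFinset := by simpa using hA.1
      rw [this, List.map_append, List.sum_append, ihr]
      simp only [List.toFinset_cons, Finset.sum_powerset_insert hx]
      simp only [List.map_cons, List.map_nil, List.sum_cons, List.sum_nil, add_zero,
        List.toFinset_cons, Finset.insert_union, Finset.union_insert]
      ring

theorem sum_signedSubsets (f : Finset ℕ → ℂ) {A : List ℕ} (hA : A.Nodup) :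
    ((signedSubsets A).map fun q => f q.2.toFinset).sum = ∑ U ∈ A.toFinset.powerset, f U := by
  rw [signedSubsets, sum_foldl_signedStep_powerset f A hA]
  simp

/-! ### The search for connected sets -/

section Search

variable (n s : ℕ) (G : SimpleGraph ℕ) (c : Finset ℕ → ℂ)

/-- The sum of `c S` over the sets `S` that contain `A` and avoid `X`. -/
def weight (A X : List ℕ) : ℂ :=
  ∑ S ∈ (Finset.range n).powerset with (∀ a ∈ A, a ∈ S) ∧ ∀ x ∈ X, x ∉ S, c S

theorem weight_split (A X : List ℕ) (w : ℕ) :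
    weight n c (w :: A) X + weight n c A (w :: X) = weight n c A X := by
  unfold weight
  rw [← Finset.sum_filter_add_sum_filter_not (Finset.filter (fun S => (∀ a ∈ A, a ∈ S) ∧
    ∀ x ∈ X, x ∉ S) (Finset.range n).powerset) (fun S => w ∈ S)]
  congr 1
  · refine Finset.sum_congr ?_ fun _ _ => rfl
    ext S
    simp only [Finset.mem_filter, List.forall_mem_cons]
    tauto
  · refine Finset.sum_congr ?_ fun _ _ => rfl
    ext S
    simp only [Finset.mem_filter, List.forall_mem_cons]
    tauto

/-- The invariant of the search. -/
structure SearchInv (q : SearchState) : Prop where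
  nodup : q.1.Nodup
  ne_nil : q.1 ≠ []
  lt : ∀ a ∈ q.1, a < n
  lt' : ∀ a ∈ q.2.2, a < n
  disj : ∀ a ∈ q.1, a ∉ q.2.1
  closed : ∀ a ∈ q.1, ∀ v, G.Adj a v → v ∈ q.1 ∨ v ∈ q.2.1 ∨ v ∈ q.2.2

variable {n s G c}

/-- The sets counted by a state either contain the next vertex or avoid it, so branching splits the
weight. Choosing a vertex puts all its neighbours on the waiting list, which keeps the chosen set
closed. -/
theorem searchStep_inv {g : List (List ℕ)} (hg : ∀ a v, v ∈ g.getD a [] ↔ G.Adj a v)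
    (hn : ∀ a v, G.Adj a v → v < n) (hc : ∀ S : Finset ℕ, s < S.card → c S = 0)
    {q : SearchState} (hq : SearchInv n G q) :
    (∀ q' ∈ searchStep g s q, SearchInv n G q') ∧
      ((searchStep g s q).map fun q' => weight n c q'.1 q'.2.1).sum = weight n c q.1 q.2.1 := by
  obtain ⟨A, X, F⟩ := q
  obtain ⟨h1, h2, h3, h4, h5, h6⟩ := hq
  dsimp only at h1 h2 h3 h4 h5 h6
  cases F with
  | nil =>
    rw [searchStep_of_eq_nil]
    simpa using ⟨h1, h2, h3, h4, h5, h6⟩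
  | cons w F =>
    have hexcl : w ∉ A → SearchInv n G (A, w :: X, F) := fun hw =>
      { nodup := h1, ne_nil := h2, lt := h3, lt' := fun a ha => h4 a (by simp [ha]),
        disj := fun a ha => by
          rw [List.mem_cons, not_or]
          exact ⟨fun e => hw (e ▸ ha), h5 a ha⟩
        closed := fun a ha v hv => by
          have := h6 a ha v hv
          simp only [List.mem_cons] at this ⊢
          tauto }
    rw [searchStep_cons]
    split_ifs with hw hs
    · refine ⟨?_, by simp⟩
      intro q' hq'
      rw [List.mem_singleton] at hq'
      subst hq'
      refine ⟨h1, h2, h3, fun a ha => h4 a (by simp [ha]), h5, fun a ha v hv => ?_⟩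
      have := h6 a ha v hv
      simp only [List.mem_cons] at this ⊢
      rcases this with h | h | rfl | h <;> tauto
    · rw [not_or] at hw
      refine ⟨?_, by simpa using weight_split n c A X w⟩
      intro q' hq'
      rw [List.mem_pair] at hq'
      rcases hq' with rfl | rfl
      · refine ⟨List.nodup_cons.2 ⟨hw.1, h1⟩, by simp, ?_, ?_, ?_, ?_⟩
        · rw [List.forall_mem_cons]
          exact ⟨h4 w (by simp), h3⟩
        · intro a ha
          rcases List.mem_append.1 ha with ha | ha
          · exact hn w a ((hg w a).1 ha)
          · exact h4 a (by simp [ha])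
        · rw [List.forall_mem_cons]
          exact ⟨hw.2, h5⟩
        · intro a ha v hv
          simp only [List.mem_cons, List.mem_append] at ha ⊢
          rcases ha with rfl | ha
          · exact Or.inr (Or.inr (Or.inl ((hg a v).2 hv)))
          · have := h6 a ha v hv
            simp only [List.mem_cons] at this
            tauto
      · exact hexcl hw.1
    · rw [not_or] at hw
      refine ⟨?_, ?_⟩
      · intro q' hq'
        rw [List.mem_singleton] at hq'
        subst hq'
        exact hexcl hw.1
      -- Discarding this branch is harmless: its sets have more than `s` elements, where `c`
      -- vanishes.
      · have hz : weight n c (w :: A) X = 0 := by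
          refine Finset.sum_eq_zero fun S hS => hc S ?_
          rw [Finset.mem_filter] at hS
          have hsub : (w :: A).toFinset ⊆ S := fun a ha => hS.2.1 a (by simpa using ha)
          have := Finset.card_le_card hsub
          rw [List.toFinset_card_of_nodup (List.nodup_cons.2 ⟨hw.1, h1⟩), List.length_cons] at this
          omega
        have := weight_split n c A X w
        rw [hz, zero_add] at this
        simpa using this

/-- With nothing left to consider, all outside neighbours of `A` are excluded. A larger set S of
this state has no edges between `A` and S \ A, hence contributes zero. -/
theorem SearchInv.weight_eq {A X : List ℕ} (h : SearchInv n G (A, X, []))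
    (hdis : ∀ A B : Finset ℕ, A.Nonempty → B.Nonempty → Disjoint A B →
      (∀ a ∈ A, ∀ b ∈ B, ¬G.Adj a b) → c (A ∪ B) = 0) : weight n c A X = c A.toFinset := by
  obtain ⟨h1, h2, h3, -, h5, h6⟩ := h
  dsimp only at h1 h2 h3 h5 h6
  rw [weight, Finset.sum_eq_single A.toFinset]
  · intro S hS hne
    rw [Finset.mem_filter] at hS
    have hsub : A.toFinset ⊆ S := fun a ha => hS.2.1 a (by simpa using ha)
    rw [← Finset.union_sdiff_of_subset hsub]
    refine hdis _ _ ?_ ?_ Finset.disjoint_sdiff ?_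
    · rwa [List.toFinset_nonempty_iff]
    · rw [Finset.sdiff_nonempty]
      exact fun h => hne (h.antisymm hsub)
    · intro a ha b hb hab
      rw [Finset.mem_sdiff, List.mem_toFinset] at hb
      rcases h6 a (by simpa using ha) b hab with h | h | h
      · exact hb.2 h
      · exact hS.2.2 b h hb.1
      · simp at h
  · intro h
    refine absurd ?_ h
    simp only [Finset.mem_filter, Finset.mem_powerset, List.mem_toFinset, imp_self, implies_true,
      true_and]
    exact ⟨fun a ha => Finset.mem_range.2 (h3 a (by simpa using ha)), fun x hx hxA => h5 x hxA hx⟩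

/-- The initial state at `v` accounts for the sets with largest element `v`; the form as a
difference makes the sum over `v` telescope. -/
theorem weight_singleton {v : ℕ} (hv : v < n) :
    weight n c [v] ((List.range n).filter fun w => !decide (w ≤ v)) =
      ∑ S ∈ (Finset.range (v + 1)).powerset, c S - ∑ S ∈ (Finset.range v).powerset, c S := by
  rw [eq_sub_iff_add_eq, ← Finset.sum_filter_add_sum_filter_not (Finset.range (v + 1)).powerset
    (fun S => v ∈ S), weight]
  congr 1
  · refine Finset.sum_congr ?_ fun _ _ => rfl
    ext S
    simp only [Finset.mem_filter, Finset.mem_powerset, List.mem_singleton, forall_eq,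
      List.mem_filter, List.mem_range, Bool.not_eq_true', decide_eq_false_iff_not]
    constructor
    · rintro ⟨h1, h2, h3⟩
      refine ⟨fun a ha => Finset.mem_range.2 ?_, h2⟩
      by_contra h
      exact h3 a ⟨Finset.mem_range.1 (h1 ha), by omega⟩ ha
    · rintro ⟨h1, h2⟩
      refine ⟨fun a ha => Finset.mem_range.2 ?_, h2, fun a ha ha' => ?_⟩
      · have := Finset.mem_range.1 (h1 ha)
        omega
      · have := Finset.mem_range.1 (h1 ha')
        omega
  · refine Finset.sum_congr ?_ fun _ _ => rfl
    ext S
    simp only [Finset.mem_filter, Finset.mem_powerset, Finset.range_add_one]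
    constructor
    · intro h
      exact ⟨h.trans (Finset.subset_insert _ _), fun hv => by simpa using h hv⟩
    · rintro ⟨h1, h2⟩
      exact (Finset.subset_insert_iff_of_notMem h2).1 h1

theorem search_inv {g : List (List ℕ)} (hgn : g.length = n)
    (hg : ∀ a v, v ∈ g.getD a [] ↔ G.Adj a v)
    (hn : ∀ a v, G.Adj a v → v < n) (hc : ∀ S : Finset ℕ, s < S.card → c S = 0) (rs : List ℕ) :
    (∀ q ∈ search g s rs, SearchInv n G q) ∧
      ((search g s rs).map fun q => weight n c q.1 q.2.1).sum =
        ∑ S ∈ (Finset.range n).powerset, c S - c ∅ := by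
  induction rs using List.reverseRecOn with
  | nil =>
    refine ⟨?_, ?_⟩
    · intro q hq
      simp only [search, searchInit, List.foldl_nil, List.mem_map, List.mem_range, hgn] at hq
      obtain ⟨v, hv, rfl⟩ := hq
      refine ⟨by simp, by simp, by simpa using hv, fun a ha => hn v a ((hg v a).1 ha), ?_, ?_⟩
      · simp
      · intro a ha w hw
        rw [List.mem_singleton] at ha
        subst ha
        exact Or.inr (Or.inr ((hg a w).2 hw))
    · simp only [search, searchInit, List.foldl_nil, List.map_map, Function.comp_def, hgn]
      rw [← List.sum_toFinset _ List.nodup_range, List.toFinset_range,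
        Finset.sum_congr rfl fun v hv => weight_singleton (Finset.mem_range.1 hv),
        Finset.sum_range_sub (fun v => ∑ S ∈ (Finset.range v).powerset, c S)]
      simp
  | append_singleton rs r ih =>
    rw [search_concat]
    obtain ⟨ih1, ih2⟩ := ih
    refine ⟨?_, ?_⟩
    · intro q' hq'
      obtain ⟨q, hq, h⟩ := List.mem_flatMap.1 hq'
      exact (searchStep_inv (c := c) hg hn hc (ih1 q hq)).1 q' h
    · rw [← ih2, List.map_flatMap, List.flatMap_def, List.sum_flatten, List.map_map]
      refine congrArg _ (List.map_congr_left fun q hq => ?_)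
      exact (searchStep_inv hg hn hc (ih1 q hq)).2

/-- Conservation of weight replaces a proof that every connected set is visited exactly once. -/
theorem sum_search {g : List (List ℕ)} {d : ℕ} (hgn : g.length = n) (hgd : ∀ r ∈ g, r.length ≤ d)
    (hg : ∀ a v, v ∈ g.getD a [] ↔ G.Adj a v) (hn : ∀ a v, G.Adj a v → v < n) (hs : 1 ≤ s)
    (hc : ∀ S : Finset ℕ, s < S.card → c S = 0)
    (hdis : ∀ A B : Finset ℕ, A.Nonempty → B.Nonempty → Disjoint A B →
      (∀ a ∈ A, ∀ b ∈ B, ¬G.Adj a b) → c (A ∪ B) = 0)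
    {rs : List ℕ} (hrs : d * s ≤ rs.length) :
    ((search g s rs).map fun q => c q.1.toFinset).sum =
      ∑ S ∈ (Finset.range n).powerset, c S - c ∅ := by
  obtain ⟨h1, h2⟩ := search_inv hgn hg hn hc rs
  rw [← h2]
  refine congrArg _ (List.map_congr_left fun q hq => ?_)
  have h3 := search_done hgd hs hrs q hq
  have h4 := h1 q hq
  obtain ⟨A, X, F⟩ := q
  dsimp only at h3
  subst h3
  exact (h4.weight_eq hdis).symm

end Search

/-! ### Correctness of the algorithm -/

section Correctness

variable {p : GraphClass → ℂ[X]} {α : ℕ} {lam : GraphClass → ℕ → ℂ} (G : SimpleGraph ℕ)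

/-- The number `λ_{H, i}` of the subgraph `H` induced on the list `U`. -/
def listCoeff (lam : GraphClass → ℕ → ℂ) (U : List ℕ) (i : ℕ) : ℂ := lam (subClass G U.toFinset) i

theorem coeffSum_eq (h : ∀ (n : ℕ) (G : SimpleGraph (Fin n)) (i : ℕ), (p (isoClass G)).coeff i =
      ∑ H ∈ GraphClass.orderLE (α * i), lam H i * (ind H G : ℂ)) {T : List ℕ} (hT : T.Nodup)
    (i : ℕ) : coeffSum α (listCoeff G lam) T i = (p (subClass G T.toFinset)).coeff i := by
  rw [coeff_subClass G h, ← sum_signedSubsets _ hT, coeffSum]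
  refine congrArg _ (List.map_congr_left fun q hq => ?_)
  rw [List.toFinset_card_of_nodup (nodup_of_mem_signedSubsets hT hq)]
  simp [listCoeff]

theorem List.filter_le_range {m j : ℕ} (h : j < m) :
    ((List.range m).filter fun k => decide (k ≤ j)) = List.range (j + 1) := by
  obtain ⟨e, rfl⟩ := Nat.exists_eq_add_of_lt h
  rw [show j + e + 1 = (j + 1) + e by omega, List.range_add, List.filter_append,
    List.filter_eq_self.2, List.filter_eq_nil_iff.2, List.append_nil]
  · intro k hk
    obtain ⟨i, -, rfl⟩ := List.mem_map.1 hk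
    simp; omega
  · intro k hk
    have := List.mem_range.1 hk
    simp; omega

theorem lastPowerSum_eq (h : ∀ (n : ℕ) (G : SimpleGraph (Fin n)) (i : ℕ),
      (p (isoClass G)).coeff i = ∑ H ∈ GraphClass.orderLE (α * i), lam H i * (ind H G : ℂ))
    (h0 : ∀ H, (p H).coeff 0 = 1) {T : List ℕ} (hT : T.Nodup) {m j : ℕ} (hj : j < m) :
    lastPowerSum α (listCoeff G lam) T ((List.range m).filter fun k => decide (k ≤ j)) =
      invPowerSum (p (subClass G T.toFinset)) (j + 1) := by
  rw [lastPowerSum, List.filter_le_range hj, ← newton_getD_zero (h0 _)]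
  simp only [coeffSum_eq G h hT]

theorem sum_connectedTerm {n d s m j : ℕ} {g : List (List ℕ)} (hp : IsMultiplicative p)
    (h : ∀ (n : ℕ) (G : SimpleGraph (Fin n)) (i : ℕ),
      (p (isoClass G)).coeff i = ∑ H ∈ GraphClass.orderLE (α * i), lam H i * (ind H G : ℂ))
    (h0 : ∀ H, (p H).coeff 0 = 1) (hgn : g.length = n) (hgd : ∀ r ∈ g, r.length ≤ d)
    (hg : ∀ a v, v ∈ g.getD a [] ↔ G.Adj a v) (hn : ∀ a v, G.Adj a v → v < n) (hs : 1 ≤ s)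
    (hαs : α * m ≤ s) (hj : j < m) {rs : List ℕ} (hrs : d * s ≤ rs.length) :
    ((search g s rs).map fun q => connectedTerm α (listCoeff G lam) q.1 m j).sum =
      invPowerSum (p (subClass G (Finset.range n))) (j + 1) := by
  have hne : ∀ H, p H ≠ 0 := fun H hH => by simpa [hH] using h0 H
  have hdeg := HasDegree.invPowerSum (α := α) (q := fun S => p (subClass G S)) (fun S => h0 _)
    (fun i => ⟨fun T => if T.card ≤ α * i then lam (subClass G T) i else 0,
      fun T hT => if_neg (by omega), fun S => coeff_subClass G h S i⟩) j
  obtain ⟨c, hc, hf⟩ := hdeg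
  dsimp only at hf
  have hunion : ∀ A B : Finset ℕ, Disjoint A B → (∀ a ∈ A, ∀ b ∈ B, ¬G.Adj a b) →
      invPowerSum (p (subClass G (A ∪ B))) (j + 1) =
        invPowerSum (p (subClass G A)) (j + 1) + invPowerSum (p (subClass G B)) (j + 1) :=
    fun A B hAB hab => by
      rw [hp.subClass_union G hAB hab, invPowerSum_mul (mul_ne_zero (hne _) (hne _))]
  have hdis : ∀ A B : Finset ℕ, A.Nonempty → B.Nonempty → Disjoint A B →
      (∀ a ∈ A, ∀ b ∈ B, ¬G.Adj a b) → c (A ∪ B) = 0 := by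
    intro A B hA hB hAB hab
    refine coeff_eq_zero_of_additive hf ?_ ?_ fun S hS => ?_
    · exact fun hs => hA.ne_empty (Finset.disjoint_self_iff_empty A |>.1 (hAB.mono_right hs))
    · exact fun hs => hB.ne_empty (Finset.disjoint_self_iff_empty B |>.1 (hAB.mono_left hs))
    · rw [← hunion (S ∩ A) (S ∩ B)
        (hAB.mono Finset.inter_subset_right Finset.inter_subset_right)
        (fun a ha b hb => hab a (Finset.mem_of_mem_inter_right ha) b
          (Finset.mem_of_mem_inter_right hb)), ← Finset.inter_union_distrib_left,
        Finset.inter_eq_left.2 hS]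
  -- The degree α(j + 1) is at most αm, hence at most `s`.
  have hcs : ∀ S : Finset ℕ, s < S.card → c S = 0 := fun S hS => hc S
    (lt_of_le_of_lt ((Nat.mul_le_mul_left α hj).trans hαs) hS)
  have hterm : ∀ q ∈ search g s rs,
      connectedTerm α (listCoeff G lam) q.1 m j = c q.1.toFinset := by
    intro q hq
    have hnd := ((search_inv hgn hg hn hcs rs).1 q hq).nodup
    -- Möbius inversion: the alternating sum that the program evaluates is the coefficient of the
    -- visited set.
    rw [← altSum_empty hnd fun S _ => hf S, ← sum_signedSubsets_mul, connectedTerm]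
    refine congrArg _ (List.map_congr_left fun r hr => ?_)
    rw [lastPowerSum_eq G h h0 (nodup_of_mem_signedSubsets hnd hr) hj]
  have hempty : c ∅ = 0 := by
    have := hf ∅
    rw [hp.subClass_empty, invPowerSum_one] at this
    simpa using this.symm
  rw [List.map_congr_left hterm, sum_search hgn hgd hg hn hs hcs hdis hrs, hempty, sub_zero, hf]

end Correctness

/-! ### Adjacency lists -/

/-- The adjacency lists of a graph on `{0, …, n - 1}`. -/
def adjList {n : ℕ} (G : SimpleGraph (Fin n)) [DecidableRel G.Adj] : List (List ℕ) :=
  (List.finRange n).map fun v => ((List.finRange n).filter fun w => G.Adj v w).map Fin.val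

theorem enc_adjList {n : ℕ} (G : SimpleGraph (Fin n)) [DecidableRel G.Adj] :
    enc (adjList G) = encGraph G := by
  simp only [enc, adjList, encGraph, List.map_map]
  refine congrArg _ (List.map_congr_left fun v _ => ?_)
  simp [← List.map_eq_flatMap, Function.comp_def]

theorem length_adjList {n : ℕ} (G : SimpleGraph (Fin n)) [DecidableRel G.Adj] :
    (adjList G).length = n := by simp [adjList]

theorem length_le_of_mem_adjList {n Δ : ℕ} {G : SimpleGraph (Fin n)} [DecidableRel G.Adj]
    (hG : G.maxDegree ≤ Δ) : ∀ r ∈ adjList G, r.length ≤ Δ := by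
  intro r hr
  obtain ⟨v, -, rfl⟩ := List.mem_map.1 hr
  rw [List.length_map]
  refine le_trans (le_of_eq ?_) ((G.degree_le_maxDegree v).trans hG)
  rw [← List.toFinset_card_of_nodup ((List.nodup_finRange n).filter _),
    ← SimpleGraph.card_neighborFinset_eq_degree]
  congr 1
  ext w
  simp

theorem mem_getD_adjList {n : ℕ} (G : SimpleGraph (Fin n)) [DecidableRel G.Adj] (a v : ℕ) :
    v ∈ (adjList G).getD a [] ↔ (G.map Fin.valEmbedding).Adj a v := by
  rw [SimpleGraph.map_adj]
  by_cases ha : a < n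
  · rw [List.getD_eq_getElem _ _ (by simpa [adjList] using ha)]
    simp only [adjList, List.getElem_map, List.mem_map, List.mem_filter, List.mem_finRange,
      true_and, List.getElem_finRange, decide_eq_true_eq]
    constructor
    · rintro ⟨w, hw, rfl⟩
      exact ⟨_, w, hw, rfl, rfl⟩
    · rintro ⟨b, w, hw, rfl, rfl⟩
      exact ⟨w, hw, rfl⟩
  · rw [List.getD_eq_default _ _ (by simpa [adjList] using ha)]
    simp only [List.not_mem_nil, false_iff]
    rintro ⟨b, w, -, rfl, -⟩
    exact ha b.2

/-- Vertices are renamed by their positions in `U`, as the coefficient program expects a graph on an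
initial segment of the naturals. -/
theorem inducedAdj_eq {G : SimpleGraph ℕ} {g : List (List ℕ)}
    (hg : ∀ a v, v ∈ g.getD a [] ↔ G.Adj a v) (U : List ℕ)
    [DecidableRel (G.comap U.get).Adj] :
    inducedAdj g U = adjList (G.comap U.get) := by
  rw [inducedAdj, adjList, ← List.map_coe_finRange_eq_range, List.map_map]
  refine List.map_congr_left fun a _ => ?_
  rw [Function.comp_apply, List.filter_map]
  congr 1
  refine List.filter_congr fun b _ => ?_
  rw [Function.comp_apply, decide_eq_decide, hg, List.getD_eq_getElem _ _ a.2,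
    List.getD_eq_getElem _ _ b.2]
  rfl

theorem isoClass_comap_getElem (G : SimpleGraph ℕ) {U : List ℕ} (hU : U.Nodup) :
    isoClass (G.comap U.get) = subClass G U.toFinset := by
  have := isoClass_comap G ⟨U.get, fun a b h =>
    Fin.ext ((List.Nodup.getElem_inj_iff hU).1 h)⟩
  refine this.trans (congrArg _ ?_)
  ext v
  simp only [Finset.mem_map, Finset.mem_univ, true_and, List.mem_toFinset, List.mem_iff_get]
  exact Iff.rfl

theorem subClass_map_range {n : ℕ} (G : SimpleGraph (Fin n)) :
    subClass (G.map Fin.valEmbedding) (Finset.range n) = isoClass G := by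
  have := isoClass_comap (G.map Fin.valEmbedding) (Fin.valEmbedding (n := n))
  rw [SimpleGraph.comap_map_eq] at this
  rw [this]
  congr 1
  ext v
  simp only [Finset.mem_range, Finset.mem_map, Finset.mem_univ, true_and]
  exact ⟨fun h => ⟨⟨v, h⟩, rfl⟩, by rintro ⟨a, rfl⟩; exact a.2⟩

/-! ### The complete program -/

namespace Prog

/-- A list of `⌈C * log (n / ε)⌉₊` zeros, on input `(g, ε)`, where `g` has length `n`. -/
def logList (C : ℝ) : Prog :=
  .seq (.fork cdr (.fork (quote .nil) (.seq car length))) <|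
  .seq (.loop (not (app₂ (.op .le) (.seq cdr cdr) car))
    (.fork (app₂ (.op .mul) car (quote (.num (Real.exp (1 / C)))))
      (.fork (.fork (quote (.num 0)) (.seq cdr car)) (.seq cdr cdr))))
  (.seq cdr car)

/-- The inverse power sums, on input `(g, ε)`, where `A` computes the numbers `λ_{H, i}`. -/
def powerSums (C : ℝ) (Δ α : ℕ) (A : Prog) : Prog :=
  bind (logList C) <| bind (.seq car positions) <|
  bind (.seq (.fork
      (flatMap (.fork (quote (.num 0)) (var 0))
        (quote (enc (List.replicate (Δ * (α + 1)) (0 : ℕ)))))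
      (.fork (var 2) (app₂ (.op .add)
        (app₂ (.op .mul) (quote (enc α)) (.seq (var 1) length)) (quote (.num 1))))) search) <|
  map (var 1) <| .seq (map (var 1) <| .seq (.fork (.seq (var 0) car) (.fork (var 1)
    (.fork (var 5) (var 3)))) (connectedTerm α A)) sumComplex

end Prog

/-- Logarithms are not primitive operations. The number of power sums is instead found by
multiplying ε by the real constant e^{1/C} until `x` is reached. -/
theorem lt_ceil_mul_log_iff {C x ε : ℝ} (hC : 0 < C) (hx : 0 < x) (hε : 0 < ε) (j : ℕ) :
    j < ⌈C * Real.log (x / ε)⌉₊ ↔ ¬x ≤ ε * Real.exp (1 / C) ^ j := by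
  rw [← not_le, Nat.ceil_le, not_iff_not, ← Real.exp_nat_mul, mul_comm ε, ← div_le_iff₀ hε,
    ← Real.log_le_iff_le_exp (div_pos hx hε), mul_one_div, le_div_iff₀ hC, mul_comm C]

/-- The inputs. -/
structure ProblemInstance (Δ : ℕ) : Type where
  n : ℕ
  G : SimpleGraph (Fin n)
  dec : DecidableRel G.Adj
  ε : ℝ
  n_pos : 0 < n
  maxDegree_le : G.maxDegree ≤ Δ
  ε_pos : 0 < ε

namespace ProblemInstance

variable {Δ : ℕ}

instance (i : ProblemInstance Δ) : DecidableRel i.G.Adj := i.dec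

/-- The size of an input: `n + n / ε`, up to rounding. -/
def size (i : ProblemInstance Δ) : ℕ := i.n + ⌈(i.n : ℝ) / i.ε⌉₊

/-- The adjacency lists. -/
def adj (i : ProblemInstance Δ) : List (List ℕ) := adjList i.G

/-- The graph, as a graph on the natural numbers. -/
def graph (i : ProblemInstance Δ) : SimpleGraph ℕ := i.G.map Fin.valEmbedding

/-- The number of inverse power sums. -/
def num (C : ℝ) (i : ProblemInstance Δ) : ℕ := ⌈C * Real.log ((i.n : ℝ) / i.ε)⌉₊

theorem length_adj (i : ProblemInstance Δ) : i.adj.length = i.n :=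
  length_adjList i.G

theorem polyBounded_n : PolyBounded (size (Δ := Δ)) n :=
  PolyBounded.size.mono fun _ => Nat.le_add_right _ _

theorem polyBounded_adj : PolyBounded (size (Δ := Δ)) fun i => i.adj.length := by
  simpa only [length_adj] using polyBounded_n

theorem length_le_of_mem_adj (i : ProblemInstance Δ) : ∀ r ∈ i.adj, r.length ≤ Δ :=
  length_le_of_mem_adjList i.maxDegree_le

theorem mem_adj (i : ProblemInstance Δ) (a v : ℕ) : v ∈ i.adj.getD a [] ↔ i.graph.Adj a v :=
  mem_getD_adjList i.G a v

theorem graph_adj_lt (i : ProblemInstance Δ) (a v : ℕ) (h : i.graph.Adj a v) : v < i.n := by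
  obtain ⟨_, w, -, -, rfl⟩ := (SimpleGraph.map_adj ..).1 h
  exact w.2

/-- The point is that b^{C log x} = x^{C log b}: what is exponential in the number of power sums is
polynomial in the input size. Passing to `b + 1` makes the logarithm of the base nonnegative. -/
theorem polyBounded_pow_num {C : ℝ} (hC : 0 < C) (b : ℕ) :
    PolyBounded (size (Δ := Δ)) fun i => b ^ i.num C := by
  refine PolyBounded.mono (t := fun i => (b + 1) ^ i.num C) ?_
    fun i => Nat.pow_le_pow_left (Nat.le_succ b) _
  obtain ⟨k, hk⟩ := exists_nat_ge (C * Real.log ((b + 1 : ℕ) : ℝ))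
  -- The exponent `k` covers C log(b + 1), and `b + 1` covers the extra factor due to rounding up,
  -- since b + 1 ≤ 2^{b+1}.
  refine ⟨b + 1 + k, fun i => ?_⟩
  have hb : (0 : ℝ) < ((b + 1 : ℕ) : ℝ) := by positivity
  have hlogb : 0 ≤ Real.log ((b + 1 : ℕ) : ℝ) := Real.log_natCast_nonneg _
  have hS : (0 : ℝ) < ((i.size + 2 : ℕ) : ℝ) := by positivity
  have hL2 : Real.log 2 ≤ Real.log ((i.size + 2 : ℕ) : ℝ) :=
    Real.log_le_log (by norm_num) (by push_cast; linarith [Nat.cast_nonneg (α := ℝ) i.size])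
  have hL : 0 ≤ Real.log ((i.size + 2 : ℕ) : ℝ) := Real.log_natCast_nonneg _
  have hx : 0 < (i.n : ℝ) / i.ε := div_pos (Nat.cast_pos.2 i.n_pos) i.ε_pos
  have hxS : (i.n : ℝ) / i.ε ≤ ((i.size + 2 : ℕ) : ℝ) := by
    refine (Nat.le_ceil _).trans (Nat.cast_le.2 ?_)
    unfold size
    omega
  have hm : (i.num C : ℝ) ≤ C * Real.log ((i.size + 2 : ℕ) : ℝ) + 1 := by
    have h1 : i.num C ≤ ⌈C * Real.log ((i.size + 2 : ℕ) : ℝ)⌉₊ :=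
      Nat.ceil_mono (mul_le_mul_of_nonneg_left (Real.log_le_log hx hxS) hC.le)
    exact (Nat.cast_le.2 h1).trans (Nat.ceil_lt_add_one (by positivity)).le
  have hbb : Real.log ((b + 1 : ℕ) : ℝ) ≤ (b + 1 : ℕ) * Real.log 2 := by
    rw [← Real.log_pow]
    exact Real.log_le_log hb (by exact_mod_cast Nat.lt_two_pow_self.le)
  have key : (i.num C : ℝ) * Real.log ((b + 1 : ℕ) : ℝ) ≤
      ((b + 1 + k : ℕ) : ℝ) * Real.log ((i.size + 2 : ℕ) : ℝ) := by
    calc (i.num C : ℝ) * Real.log ((b + 1 : ℕ) : ℝ)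
        ≤ (C * Real.log ((i.size + 2 : ℕ) : ℝ) + 1) * Real.log ((b + 1 : ℕ) : ℝ) :=
          mul_le_mul_of_nonneg_right hm hlogb
      _ = C * Real.log ((b + 1 : ℕ) : ℝ) * Real.log ((i.size + 2 : ℕ) : ℝ) +
          Real.log ((b + 1 : ℕ) : ℝ) := by ring
      _ ≤ k * Real.log ((i.size + 2 : ℕ) : ℝ) +
          (b + 1 : ℕ) * Real.log ((i.size + 2 : ℕ) : ℝ) :=
          add_le_add (mul_le_mul_of_nonneg_right hk hL)
            (hbb.trans (mul_le_mul_of_nonneg_left hL2 (Nat.cast_nonneg _)))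
      _ = _ := by push_cast; ring
  rw [← Real.log_pow, ← Real.log_pow] at key
  have := (Real.log_le_log_iff (pow_pos hb _) (pow_pos hS _)).1 key
  exact_mod_cast this

theorem polyBounded_num {C : ℝ} (hC : 0 < C) : PolyBounded (size (Δ := Δ)) (num C) :=
  (polyBounded_pow_num hC 2).mono fun _ => Nat.lt_two_pow_self.le

theorem polyBounded_pow_mul_num_add {C : ℝ} (hC : 0 < C) (b c d : ℕ) :
    PolyBounded (size (Δ := Δ)) fun i => b ^ (c * i.num C + d) := by
  simpa only [pow_add, pow_mul] using (polyBounded_pow_num hC (b ^ c)).mul (.const (b ^ d))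

theorem callable {C : ℝ} (hC : 0 < C) {A : Prog} {lam : GraphClass → ℕ → ℂ} {α β : ℕ}
    (hA : ComputesCoefficients A lam α β) :
    Callable (size (Δ := Δ)) A α adj (fun i => α * i.num C + 1)
      (fun i => listCoeff i.graph lam) := by
  obtain ⟨K, hK⟩ := hA
  obtain ⟨c, hc⟩ := (PolyBounded.const K).mul
    (polyBounded_pow_mul_num_add (Δ := Δ) hC (β + 1) α 1)
  refine ⟨c, fun i U k hU hα hs => ?_⟩
  classical
  obtain ⟨t, hrun, ht⟩ := hK U.length (i.graph.comap U.get) k hα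
  refine ⟨t, ht.trans (le_trans (Nat.mul_le_mul_left _ ?_) (hc i)), ?_⟩
  -- The base is raised to β + 1 because powers of β = 0 are not monotone in the exponent.
  · exact (Nat.pow_le_pow_left (Nat.le_succ β) _).trans (Nat.pow_le_pow_right (by omega) hs)
  · rw [isoClass_comap_getElem _ hU, ← enc_adjList, ← inducedAdj_eq i.mem_adj] at hrun
    exact hrun

end ProblemInstance

namespace PolyTime

variable {Δ : ℕ}

open ProblemInstance

theorem logList {C : ℝ} (hC : 0 < C) :
    PolyTime (size (Δ := Δ)) (.logList C) (fun i => (i.adj, i.ε))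
      (fun i => List.replicate (i.num C) (0 : ℕ)) := by
  have hn : PolyTime (size (Δ := Δ)) (.seq .car .length) (fun i => (i.adj, i.ε))
      (fun i => (i.n : ℝ)) := by
    have h : PolyTime (size (Δ := Δ)) (.seq .car .length) (fun i => (i.adj, i.ε)) (fun i => i.n) :=
      (car.seq (length polyBounded_adj)).congr length_adj
    -- A natural number and its real cast have the same representation.
    exact h
  refine (cdr.fork ((nil (X := ℕ)).fork hn)).seq (seq
    (x := fun i : ProblemInstance Δ => (i.ε * Real.exp (1 / C) ^ i.num C,
      List.replicate (i.num C) (0 : ℕ), (i.n : ℝ))) ?_ (cdr.seq car))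
  have := loop (M := size (Δ := Δ)) (polyBounded_num hC)
    (fun i j => (i.ε * Real.exp (1 / C) ^ j, List.replicate j (0 : ℕ), (i.n : ℝ)))
    ((not (app₂ le_real (cdr.seq cdr) car)).congr fun j => ?_)
    (fork ((app₂ mul_real car (quote (Real.exp (1 / C)))).congr fun j => ?_)
      (fork (cons quote_zero (cdr.seq car)) (cdr.seq cdr)))
  · simp only [pow_zero, mul_one, List.replicate_zero] at this
    exact this
  · rw [← decide_not, decide_eq_decide]
    exact (lt_ceil_mul_log_iff hC (Nat.cast_pos.2 j.i.n_pos) j.i.ε_pos j.j).symm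
  · rw [pow_succ, mul_assoc]

theorem powerSums {C : ℝ} (hC : 0 < C) {α β : ℕ} {A : Prog} {lam : GraphClass → ℕ → ℂ}
    (hA : ComputesCoefficients A lam α β) :
    PolyTime (size (Δ := Δ)) (.powerSums C Δ α A) (fun i => (i.adj, i.ε)) (fun i =>
      (List.range (i.num C)).map fun j => ((_root_.search i.adj (α * i.num C + 1)
        ((0 :: List.range (i.num C)).flatMap fun _ => List.replicate (Δ * (α + 1)) 0)).map fun q =>
          _root_.connectedTerm α (listCoeff i.graph lam) q.1 (i.num C) j).sum) := by
  have hs : PolyBounded (size (Δ := Δ)) fun i => 2 ^ (α * i.num C + 1) :=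
    polyBounded_pow_mul_num_add hC 2 α 1
  have hlist : PolyBounded (size (Δ := Δ)) fun i => (List.replicate (i.num C) (0 : ℕ)).length := by
    simpa using polyBounded_num hC
  have hjs : PolyBounded (size (Δ := Δ)) fun i => (List.range (i.num C)).length := by
    simpa using polyBounded_num hC
  have hrs : PolyBounded (size (Δ := Δ)) fun i => 2 ^ ((0 :: List.range (i.num C)).flatMap
      fun _ => List.replicate (Δ * (α + 1)) (0 : ℕ)).length := by
    -- There are m + 1 blocks of Δ(α + 1) rounds, one for each of the m power sums and one for the
    -- extra 0.
    refine (polyBounded_pow_mul_num_add hC 2 (Δ * (α + 1)) (Δ * (α + 1))).mono fun i => ?_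
    refine Nat.pow_le_pow_right (by omega) (le_of_eq ?_)
    simp only [List.length_flatMap, List.length_replicate, List.map_const', List.sum_replicate,
      List.length_cons, List.length_range, smul_eq_mul]
    ring
  have hgd : ∀ i : ProblemInstance Δ, ∀ r ∈ i.adj, r.length ≤ Δ := length_le_of_mem_adj
  have hsearch : PolyBounded (size (Δ := Δ)) fun i => (_root_.search i.adj (α * i.num C + 1)
      ((0 :: List.range (i.num C)).flatMap fun _ => List.replicate (Δ * (α + 1)) 0)).length :=
    (hrs.mul polyBounded_adj).mono fun i => length_search_le _ _ _
  refine bind (logList hC) (bind (x := fun i => List.range (i.num C))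
    ((car.seq (positions hlist)).congr fun i => by simp) (bind
    (x := fun i => _root_.search i.adj (α * i.num C + 1)
      ((0 :: List.range (i.num C)).flatMap fun _ => List.replicate (Δ * (α + 1)) 0)) ?_ ?_))
  · refine seq (fork (flatMap (cons quote_zero var_zero) (by simpa using hjs.add (.const 1))
      (.const _) (quote (List.replicate (Δ * (α + 1)) (0 : ℕ)))) (fork var₂ (app₂ add_nat
        (app₂ mul_nat (quote α) ((var₁.seq (length hlist)).congr fun i => ?_)) quote_one)))
      (search polyBounded_adj (.const Δ) hgd (fun i => by omega)
        (hs.mono fun i => Nat.lt_two_pow_self.le) hrs)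
    simp
  · refine map var₁ hjs (seq (map var₁ (hsearch.comap MemIdx.i) ?_)
      (sumComplex (by simpa using hsearch.comap MemIdx.i)))
    -- The environment here is: search state, j, all states, range of m, list of zeros, adjacency
    -- lists, ε.
    refine seq (fork (car.seq car) (fork var₁ (fork var₅ var₃)))
      (connectedTerm ((polyBounded_adj.comap MemIdx.i).comap MemIdx.i) (.const Δ)
        (fun j => hgd _) ((hs.comap MemIdx.i).comap MemIdx.i)
        (((callable hC hA).comap MemIdx.i).comap MemIdx.i) (fun j => ?_) (fun j => ?_)
        (((polyBounded_num hC).comap MemIdx.i).comap MemIdx.i))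
    -- Only the invariant of the states matters, so the weights may be taken to be zero.
    · exact ((search_inv (c := fun _ => 0) (length_adj _) (mem_adj _) (graph_adj_lt _)
        (fun _ _ => rfl) _).1 j.x j.mem).nodup
    · exact (search_bound (hgd _) (by omega) _ j.x j.mem).1

end PolyTime

end

/-! ### Assembly of correctness and running time -/

theorem theorem3p2 (C : ℝ) (hC : 0 < C) (Δ : ℕ) (p : GraphClass → ℂ[X]) (hp : IsBIGCP p) :
    ∃ (P : Prog) (K : ℕ), ∀ (n : ℕ) (G : SimpleGraph (Fin n)) [DecidableRel G.Adj] (ε : ℝ),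
      0 < n → G.maxDegree ≤ Δ → 0 < ε →
        ∃ t : ℕ,
          P.Run (Val.cons (encGraph G) (Val.num ε))
            (encList ((List.range ⌈C * Real.log ((n : ℝ) / ε)⌉₊).map fun j =>
              encComplex (invPowerSum (p (isoClass G)) (j + 1)))) t ∧
          (t : ℝ) ≤ K * max (n : ℝ) ((n : ℝ) / ε) ^ K := by
  obtain ⟨α, β, lam, hlam, A, hA⟩ := hp.bounded
  obtain ⟨b, ⟨c, hb⟩, hrun⟩ := PolyTime.powerSums (Δ := Δ) hC hA
  -- The size plus 2 is at most five times the maximum: n and n/ε give one each, rounding and the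
  -- summand 2 give three, as the maximum is at least 1. Since c < 5^c, the same number serves as
  -- factor and as exponent.
  refine ⟨.powerSums C Δ α A, 5 ^ c, fun n G inst ε hn hG hε => ?_⟩
  let i : ProblemInstance Δ := ⟨n, G, inst, ε, hn, hG, hε⟩
  obtain ⟨t, ht, h⟩ := hrun i
  refine ⟨t, ?_, ?_⟩
  · have hout : ∀ j ∈ List.range (i.num C), ((search i.adj (α * i.num C + 1)
        ((0 :: List.range (i.num C)).flatMap fun _ => List.replicate (Δ * (α + 1)) 0)).map fun q =>
          connectedTerm α (listCoeff i.graph lam) q.1 (i.num C) j).sum =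
        invPowerSum (p (isoClass G)) (j + 1) := by
      intro j hj
      rw [sum_connectedTerm i.graph (n := n) (d := Δ) hp.multiplicative hlam hp.coeff_zero
        i.length_adj i.length_le_of_mem_adj i.mem_adj i.graph_adj_lt (by omega) (by omega)
        (List.mem_range.1 hj)]
      · rw [← subClass_map_range G]
        rfl
      · simp only [List.length_flatMap, List.length_replicate, List.map_const', List.sum_replicate,
          List.length_cons, List.length_range, smul_eq_mul]
        -- The search runs with s = αm + 1, where the summand 1 keeps s positive; the m + 1 blocks
        -- supply the Δs rounds that it needs.
        calc Δ * (α * i.num C + 1) ≤ Δ * ((i.num C + 1) * (α + 1)) :=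
              Nat.mul_le_mul_left _ (by nlinarith)
          _ = _ := by ring
    dsimp only at h
    rw [List.map_congr_left hout] at h
    have e1 : Enc.enc (i.adj, i.ε) = Val.cons (encGraph G) (Val.num ε) := by
      rw [← enc_adjList]
      rfl
    rw [e1] at h
    convert h using 1
    simp only [Enc.enc, List.map_map]
    rfl
  · have h1 : (t : ℝ) ≤ ((i.size + 2 : ℕ) : ℝ) ^ c := by exact_mod_cast ht.trans (hb i)
    have hn1 : (1 : ℝ) ≤ n := by exact_mod_cast hn
    have hmax : (1 : ℝ) ≤ max (n : ℝ) ((n : ℝ) / ε) := hn1.trans (le_max_left _ _)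
    have h2 : ((i.size + 2 : ℕ) : ℝ) ≤ 5 * max (n : ℝ) ((n : ℝ) / ε) := by
      have hceil : (⌈(n : ℝ) / ε⌉₊ : ℝ) < (n : ℝ) / ε + 1 := Nat.ceil_lt_add_one (by positivity)
      have e : ((i.size + 2 : ℕ) : ℝ) = n + ⌈(n : ℝ) / ε⌉₊ + 2 := by
        simp [ProblemInstance.size, i]
      rw [e]
      have := le_max_left (n : ℝ) ((n : ℝ) / ε)
      have := le_max_right (n : ℝ) ((n : ℝ) / ε)
      linarith
    calc (t : ℝ) ≤ (5 * max (n : ℝ) ((n : ℝ) / ε)) ^ c :=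
          h1.trans (pow_le_pow_left₀ (Nat.cast_nonneg _) h2 c)
      _ = ((5 ^ c : ℕ) : ℝ) * max (n : ℝ) ((n : ℝ) / ε) ^ c := by rw [mul_pow]; push_cast; ring
      _ ≤ _ := mul_le_mul_of_nonneg_left (pow_le_pow_right₀ hmax
          (Nat.lt_pow_self (by norm_num)).le) (Nat.cast_nonneg _)
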